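/- Binary model: start with a single directed edge from a source to a sink. While the network has $n-1\ge 1$ edges, choose one of them, $(x,y)$, uniformly at random; if $x$ has out-degree $1$, add a second (parallel) edge $(x,y)$; otherwise ($x$ has out-degree $2$) replace $(x,y)$ by two edges $(x,z)$, $(z,y)$ with a new vertex $z$. The result is the random series-parallel network of size $n$ (that is, with $n$ edges). Let $L_n$, $n\ge 1$, be the length (number of edges) of a random path from the source to the sink in this network, which starts at the source and in each vertex follows an outgoing edge chosen uniformly at random until it reaches the sink. Put $\tilde\phi=\frac{\sqrt5-1}{2}$. (a) As $n\to\infty$, $L_n/n^{\tilde\phi}$ converges in distribution to a random variable $L$ whose law is the unique probability measure on $\mathbb{R}$ with the integer moments $$\mathbb{E}(L^r)=\frac{r!\,\tilde c_r}{\Gamma(r\tilde\phi+1)},\qquad r\ge 0,$$ where $\tilde c_0=1$, $\tilde c_1=\frac{3+\tilde\phi}{5}$ and $$\tilde c_r=\frac{1}{\tilde\phi\,(r-1)\,((r+1)\tilde\phi+1)}\sum_{k=1}^{r-1}(k\tilde\phi+1)\,\tilde c_k\,\tilde c_{r-k},\qquad r\ge 2.$$ (b) For all $n\ge1$, $$\mathbb{E}(L_n)=n\left(\frac{3+\sqrt5}{2\sqrt5}\binom{n+\frac{\sqrt5}{2}-\frac32}{n}-\frac{3-\sqrt5}{2\sqrt5}\binom{n-\frac{\sqrt5}{2}-\frac32}{n}\right),$$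 with $\binom{x}{n}=\frac{x(x-1)\cdots(x-n+1)}{n!}$, and, as $n\to\infty$, $$\mathbb{E}(L_n)\sim\frac{1+\sqrt5}{2\sqrt5}\cdot\frac{n^{\tilde\phi}}{\Gamma(\tilde\phi+1)}.$$ -/

import Mathlib

open MeasureTheory ProbabilityTheory Filter Topology Asymptotics

noncomputable section

/-- A directed multigraph (multiple edges allowed) on vertices named by natural numbers, with
`n` labelled edges; edge `e` runs from `tail e` to `head e`.  The vertices of the graph are the
end points of its edges; `0` is the source and `1` is the sink. -/
structure Network (n : ℕ) where
  tail : Fin n → ℕ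
  head : Fin n → ℕ

namespace Network

/-- The name of the source. -/
def source : ℕ := 0

/-- The name of the sink. -/
def sink : ℕ := 1

/-- The edges that leave the vertex `x`; their number is the out-degree of `x`. -/
def outEdges {n : ℕ} (G : Network n) (x : ℕ) : Finset (Fin n) :=
  Finset.univ.filter fun e => G.tail e = x

/-- A single edge from the source to the sink. -/
def single : Network 1 where
  tail := fun _ => source
  head := fun _ => sink

/-- Parallel doubling of the edge `j = (x, y)`: a new edge `(x, y)` with the next label. -/
def parallel {n : ℕ} (G : Network n) (j : Fin n) : Network (n + 1) where
  tail := Fin.snoc (α := fun _ => ℕ) G.tail (G.tail j)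
  head := Fin.snoc (α := fun _ => ℕ) G.head (G.head j)

/-- Serial doubling of the edge `j = (x, y)`: it is replaced by `(x, z)`, which keeps the label
`j`, and `(z, y)`, which gets the next label.  The new vertex `z` is named `n + 1`, where `n ≥ 1`
is the number of edges so far: no vertex introduced earlier has this name. -/
def serial {n : ℕ} (G : Network n) (j : Fin n) : Network (n + 1) where
  tail := Fin.snoc (α := fun _ => ℕ) G.tail (n + 1)
  head := Fin.snoc (α := fun _ => ℕ) (Function.update G.head j (n + 1)) (G.head j)

/-- Binary saturation rule for the chosen edge `j = (x, y)`: parallel doubling if `x` has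
out-degree one, serial doubling otherwise. -/
def double {n : ℕ} (G : Network n) (j : Fin n) : Network (n + 1) :=
  if (G.outEdges (G.tail j)).card = 1 then G.parallel j else G.serial j

/-- The random network with `n + 1` edges in the binary model: start with a single edge and, in
each step, apply the binary saturation rule to an edge chosen uniformly at random. -/
def binary : (n : ℕ) → PMF (Network (n + 1))
  | 0 => PMF.pure single
  | n + 1 => (binary n).bind fun G => (PMF.uniformOfFintype (Fin (n + 1))).map G.double

/-- The number of steps of a random walk on `G` from the vertex `x`, which in each vertex takes
one of the outgoing edges uniformly at random and is stopped as soon as it reaches the sink,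
or after `k` steps, or in a vertex without outgoing edges. -/
def walkLength {n : ℕ} (G : Network n) : ℕ → ℕ → PMF ℕ
  | 0, _ => PMF.pure 0
  | k + 1, x =>
      if x = sink then PMF.pure 0
      else if h : (G.outEdges x).Nonempty then
        (PMF.uniformOfFinset (G.outEdges x) h).bind fun e =>
          (walkLength G k (G.head e)).map fun l => l + 1
      else PMF.pure 0

/-- The length of a random path from the source to the sink in a given network.  The networks of
the model are acyclic, so such a path has at most `n` edges and the bound `n` on the number of
steps of the walk never takes effect. -/
def pathLength {n : ℕ} (G : Network n) : PMF ℕ :=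
  G.walkLength n source

end Network

/-- The law of the length `L_n` of a random source-to-sink path in a random network of size `n`
(i.e. with `n ≥ 1` edges) of the binary model; the value at `n = 0` is a convention. -/
def pathLengthLaw : ℕ → PMF ℕ
  | 0 => PMF.pure 0
  | n + 1 => (Network.binary n).bind fun G => G.pathLength

/-- The exponent `(√5 - 1) / 2`. -/
def phiTilde : ℝ := (√5 - 1) / 2

/-- All integer moments of `ν` exist, and the `r`-th one is `m r`. -/
def HasMoments (ν : Measure ℝ) (m : ℕ → ℝ) : Prop :=
  ∀ r : ℕ, Integrable (fun x : ℝ => x ^ r) ν ∧ ∫ x, x ^ r ∂ν = m r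

end

/-! The random path is encoded by weights that evolve autonomously. Give an edge weight `p` if its
tail has out-degree one and `q` otherwise, and let the value of a network be the mean product of
weights along the random walk. Parallel doubling turns a `p`-edge into two `q`-edges with the same
end points, so on average `p` becomes `q`. Serial doubling replaces a `q`-edge by a `q`-edge
followed by a `p`-edge, so `q` becomes `q * p`. Hence any derivation with `D p = q - p` and `D q = p
* q - q` maps the value to the sum of its changes over all possible doublings
(`Network.Admissible.derivation_pathValue`).

Take power series `f`, `a` in `z` with `(1 - z) f' = a`, `a' = a f` and `f(0) = a(0) = u`. Then `p =
(1 - z) f`, `q = (1 - z) a` and `D = (1 - z) d/dz` satisfy these rules. After division by `(1 - z) ^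
n` the derivative becomes the plain sum over doublings, so Taylor coefficients count growth
histories. For the single edge the series is `f`; with `u = exp t` its `k`-th coefficient is
therefore the moment generating series of the path length at size `k + 1`
(`Network.lexp_pathLengthLaw`).

Comparing powers of `t` gives a triangular recursion for the moments (`momentRecursion_growth`). Its
homogeneous part is solved by coefficients of `(1 - z) ^ (-(α + 1))` with `α ^ 2 + α = 1`, that is
`α = phiTilde` or `α = -phiTilde - 1`; this yields the exact mean. For `r ≥ 2` the products of lower
moments force growth of order `k ^ (r * phiTilde)`, above the homogeneous growth, and a contraction
estimate identifies the constant (`MomentRecursion.asymptotics_step`). The limiting moments grow at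
most like factorials, so they determine the law, and tightness with uniqueness of cluster points
gives weak convergence (`exists_tendsto_of_tendsto_moments`). -/

noncomputable section

namespace Network

/-! ### Weighted path sums and their change under doubling -/

section PathSum

variable {A : Type*} [CommRing A] [Algebra ℝ A] {n : ℕ}

/-- The weight `p` for an edge whose tail has out-degree one, `q` for all other edges. -/
def edgeWeight (G : Network n) (p q : A) (e : Fin n) : A :=
  if (G.outEdges (G.tail e)).card = 1 then p else q

/-- The expected product of the edge weights along a random walk with at most `k` steps. -/
def pathSum (G : Network n) (p q : A) : ℕ → ℕ → A
  | 0, _ => 1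
  | k + 1, x =>
      if x = sink ∨ G.outEdges x = ∅ then 1
      else ((G.outEdges x).card : ℝ)⁻¹ •
        ∑ e ∈ G.outEdges x, G.edgeWeight p q e * pathSum G p q k (G.head e)

theorem map_pathSum {B : Type*} [CommRing B] [Algebra ℝ B] (φ : A →ₐ[ℝ] B) (G : Network n)
    (p q : A) (k x : ℕ) : φ (G.pathSum p q k x) = G.pathSum (φ p) (φ q) k x := by
  induction k generalizing x with
  | zero => simp [pathSum]
  | succ k ih =>
    simp only [pathSum]
    split_ifs
    · simp
    · simp only [map_smul, map_sum, map_mul, ih, edgeWeight, apply_ite φ]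

/-- A function on the vertices that vanishes at the sink and decreases along the edges. -/
structure IsHeight (G : Network n) (η : ℕ → ℕ) : Prop where
  sink : η sink = 0
  lt : ∀ e, η (G.head e) < η (G.tail e)

/-- An acyclic network with sink `1`, vertices in `{0, …, n}` and paths of length at most `n`. -/
structure Admissible (G : Network n) : Prop where
  exists_height : ∃ η, G.IsHeight η ∧ η source ≤ n
  tail_le : ∀ e, G.tail e ≤ n
  head_le : ∀ e, G.head e ≤ n

theorem mem_outEdges {G : Network n} {x : ℕ} {e : Fin n} : e ∈ G.outEdges x ↔ G.tail e = x := by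
  simp [outEdges]

theorem IsHeight.outEdges_eq_empty {G : Network n} {η : ℕ → ℕ} (h : G.IsHeight η) {x : ℕ}
    (hx : η x = 0) : G.outEdges x = ∅ := by
  refine Finset.eq_empty_of_forall_notMem fun e he => ?_
  have := h.lt e
  rw [mem_outEdges.1 he] at this
  omega

/-- Each step lowers the height, so a step bound at least the height of the start never cuts a walk
short. This lets the truncated sums be replaced by a solution of the harmonic equations. -/
theorem IsHeight.pathSum_eq {G : Network n} {η : ℕ → ℕ} (h : G.IsHeight η) (p q : A) {k x : ℕ}
    (hk : η x ≤ k) : G.pathSum p q k x = G.pathSum p q (η x) x := by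
  suffices H : ∀ m k x, η x ≤ m → η x ≤ k → G.pathSum p q k x = G.pathSum p q m x from
    H _ _ _ le_rfl hk
  intro m
  induction m with
  | zero =>
    intro k x hm _
    cases k with
    | zero => rfl
    | succ k => simp [pathSum, h.outEdges_eq_empty (Nat.le_zero.1 hm)]
  | succ m ih =>
    intro k x hm hk
    cases k with
    | zero => simp [pathSum, h.outEdges_eq_empty (Nat.le_zero.1 hk)]
    | succ k =>
      simp only [pathSum]
      congr 2
      refine Finset.sum_congr rfl fun e he => ?_
      have := h.lt e
      rw [mem_outEdges.1 he] at this
      rw [ih k _ (by omega) (by omega)]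

/-- `V` solves the harmonic equations of the weighted random walk on `G`. -/
def IsValue (G : Network n) (p q : A) (V : ℕ → A) : Prop :=
  ∀ x, V x = if G.outEdges x = ∅ then 1 else ((G.outEdges x).card : ℝ)⁻¹ •
    ∑ e ∈ G.outEdges x, G.edgeWeight p q e * V (G.head e)

theorem IsHeight.isValue {G : Network n} {η : ℕ → ℕ} (h : G.IsHeight η) (p q : A) :
    G.IsValue p q fun x => G.pathSum p q (η x) x := by
  intro x
  dsimp only
  rw [← h.pathSum_eq p q (Nat.le_succ (η x)), pathSum]
  have hs : x = Network.sink → G.outEdges x = ∅ := fun hx => h.outEdges_eq_empty (hx ▸ h.sink)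
  have : (x = Network.sink ∨ G.outEdges x = ∅) ↔ G.outEdges x = ∅ := by tauto
  simp only [this]
  congr 2
  refine Finset.sum_congr rfl fun e he => ?_
  have := h.lt e
  rw [mem_outEdges.1 he] at this
  rw [h.pathSum_eq p q this.le]

theorem sum_edges_succ {M : Type*} [AddCommMonoid M] (G : Network (n + 1)) (x : ℕ)
    (F : Fin (n + 1) → M) :
    ∑ e ∈ G.outEdges x, F e = (∑ e : Fin n, if G.tail e.castSucc = x then F e.castSucc else 0) +
      if G.tail (Fin.last n) = x then F (Fin.last n) else 0 := by
  rw [outEdges, Finset.sum_filter, Fin.sum_univ_castSucc]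

theorem card_outEdges_succ (G : Network (n + 1)) (x : ℕ) :
    (G.outEdges x).card = (∑ e : Fin n, if G.tail e.castSucc = x then 1 else 0) +
      if G.tail (Fin.last n) = x then 1 else 0 := by
  rw [Finset.card_eq_sum_ones, sum_edges_succ]

theorem card_outEdges (G : Network n) (x : ℕ) :
    (G.outEdges x).card = ∑ e : Fin n, if G.tail e = x then 1 else 0 := by
  rw [Finset.card_eq_sum_ones, outEdges, Finset.sum_filter]

@[simp]
theorem parallel_tail_castSucc (G : Network n) (j e : Fin n) :
    (G.parallel j).tail e.castSucc = G.tail e := Fin.snoc_castSucc (α := fun _ => ℕ) _ _ _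

@[simp]
theorem parallel_tail_last (G : Network n) (j : Fin n) :
    (G.parallel j).tail (Fin.last n) = G.tail j := Fin.snoc_last (α := fun _ => ℕ) _ _

@[simp]
theorem parallel_head_castSucc (G : Network n) (j e : Fin n) :
    (G.parallel j).head e.castSucc = G.head e := Fin.snoc_castSucc (α := fun _ => ℕ) _ _ _

@[simp]
theorem parallel_head_last (G : Network n) (j : Fin n) :
    (G.parallel j).head (Fin.last n) = G.head j := Fin.snoc_last (α := fun _ => ℕ) _ _

@[simp]
theorem serial_tail_castSucc (G : Network n) (j e : Fin n) :
    (G.serial j).tail e.castSucc = G.tail e := Fin.snoc_castSucc (α := fun _ => ℕ) _ _ _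

@[simp]
theorem serial_tail_last (G : Network n) (j : Fin n) :
    (G.serial j).tail (Fin.last n) = n + 1 := Fin.snoc_last (α := fun _ => ℕ) _ _

@[simp]
theorem serial_head_castSucc (G : Network n) (j e : Fin n) :
    (G.serial j).head e.castSucc = if e = j then n + 1 else G.head e :=
  (Fin.snoc_castSucc (α := fun _ => ℕ) _ _ _).trans (Function.update_apply _ _ _ _)

@[simp]
theorem serial_head_last (G : Network n) (j : Fin n) :
    (G.serial j).head (Fin.last n) = G.head j := Fin.snoc_last (α := fun _ => ℕ) _ _

theorem card_outEdges_parallel (G : Network n) (j : Fin n) (x : ℕ) :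
    ((G.parallel j).outEdges x).card =
      (G.outEdges x).card + if G.tail j = x then 1 else 0 := by
  rw [card_outEdges_succ, card_outEdges]
  simp

theorem card_outEdges_serial (G : Network n) (j : Fin n) (x : ℕ) :
    ((G.serial j).outEdges x).card =
      (G.outEdges x).card + if n + 1 = x then 1 else 0 := by
  rw [card_outEdges_succ, card_outEdges]
  simp

theorem sum_outEdges_parallel {M : Type*} [AddCommMonoid M] (G : Network n) (j : Fin n) (x : ℕ)
    (F : Fin (n + 1) → M) :
    ∑ e ∈ (G.parallel j).outEdges x, F e = ∑ e ∈ G.outEdges x, F e.castSucc +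
      if G.tail j = x then F (Fin.last n) else 0 := by
  rw [sum_edges_succ, outEdges, Finset.sum_filter]
  simp

theorem sum_outEdges_serial {M : Type*} [AddCommMonoid M] (G : Network n) (j : Fin n) (x : ℕ)
    (F : Fin (n + 1) → M) :
    ∑ e ∈ (G.serial j).outEdges x, F e = ∑ e ∈ G.outEdges x, F e.castSucc +
      if n + 1 = x then F (Fin.last n) else 0 := by
  rw [sum_edges_succ, outEdges, Finset.sum_filter]
  simp

theorem Admissible.outEdges_new {G : Network n} (hG : G.Admissible) :
    G.outEdges (n + 1) = ∅ := by
  refine Finset.eq_empty_of_forall_notMem fun e he => ?_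
  have := hG.tail_le e
  rw [mem_outEdges.1 he] at this
  omega

theorem admissible_single : single.Admissible where
  exists_height := ⟨fun x => if x = source then 1 else 0, ⟨by simp [source, Network.sink],
    fun e => by simp [single, source, Network.sink]⟩, by simp⟩
  tail_le e := by simp [single, source]
  head_le e := by simp [single, Network.sink]

theorem Admissible.parallel {G : Network n} (hG : G.Admissible) (j : Fin n) :
    (G.parallel j).Admissible where
  exists_height := by
    obtain ⟨η, hη, hs⟩ := hG.exists_height
    refine ⟨η, ⟨hη.sink, fun e => ?_⟩, by omega⟩
    induction e using Fin.lastCases <;> simp [hη.lt]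
  tail_le e := by
    induction e using Fin.lastCases with
    | last => simpa using (hG.tail_le j).trans (Nat.le_succ n)
    | cast i => simpa using (hG.tail_le i).trans (Nat.le_succ n)
  head_le e := by
    induction e using Fin.lastCases with
    | last => simpa using (hG.head_le j).trans (Nat.le_succ n)
    | cast i => simpa using (hG.head_le i).trans (Nat.le_succ n)

theorem Admissible.serial {G : Network n} (hG : G.Admissible) (j : Fin n) :
    (G.serial j).Admissible where
  exists_height := by
    obtain ⟨η, hη, hs⟩ := hG.exists_height
    have hn : 0 < n := j.pos
    have hj := hη.lt j
    -- Room for the new vertex is made by raising every vertex at or above the tail of `j` by one;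
    -- the new vertex takes the vacated height of that tail.
    refine ⟨fun v => if v = n + 1 then η (G.tail j) else
      if η (G.tail j) ≤ η v then η v + 1 else η v, ⟨?_, fun e => ?_⟩, ?_⟩
    · have := hη.sink
      have h1 : Network.sink ≠ n + 1 := by simp only [Network.sink]; omega
      rw [if_neg h1, if_neg (by omega), this]
    · induction e using Fin.lastCases with
      | last =>
        have h1 := hG.head_le j
        have h2 : ¬ η (G.tail j) ≤ η (G.head j) := by omega
        have h3 : G.head j ≠ n + 1 := by omega
        simp [h2, h3, hj]
      | cast i =>
        have h1 := hG.tail_le i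
        have h2 := hG.head_le i
        have h3 := hη.lt i
        have h4 : G.tail i ≠ n + 1 := by omega
        have h5 : G.head i ≠ n + 1 := by omega
        by_cases hij : i = j
        · subst hij
          simp [h4]
        · simp only [serial_tail_castSucc, serial_head_castSucc, if_neg hij, h4, h5, if_false]
          split_ifs <;> omega
    · have h1 : source ≠ n + 1 := by simp [source]
      simp only [h1, if_false]
      split_ifs <;> omega
  tail_le e := by
    induction e using Fin.lastCases with
    | last => simp
    | cast i => simpa using (hG.tail_le i).trans (Nat.le_succ n)
  head_le e := by
    induction e using Fin.lastCases with
    | last => simpa using (hG.head_le j).trans (Nat.le_succ n)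
    | cast i =>
      by_cases hij : i = j
      · simp [hij]
      · simpa [hij] using (hG.head_le i).trans (Nat.le_succ n)

theorem Admissible.double {G : Network n} (hG : G.Admissible) (j : Fin n) :
    (G.double j).Admissible := by
  unfold Network.double
  split_ifs
  exacts [hG.parallel j, hG.serial j]

/-- The increment of the weight of an edge under doubling. -/
def weightIncrement (G : Network n) (p q : A) (e : Fin n) : A :=
  if (G.outEdges (G.tail e)).card = 1 then q - p else p * q - q

/-- Both kinds of doubling act, for the old vertices, like a change of the weight of `j` alone: from
`p` to `q`, or from `q` to `p * q`. The difference of the two harmonic equations is then a discrete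
Leibniz rule. -/
theorem IsValue.sub_double {G : Network n} (hG : G.Admissible) {p q : A} {V V' : ℕ → A}
    (hV : G.IsValue p q V) {j : Fin n} (hV' : (G.double j).IsValue p q V') {x : ℕ}
    (hx : x ≠ n + 1) :
    V' x - V x = ((G.outEdges x).card : ℝ)⁻¹ • ∑ e ∈ G.outEdges x,
      (G.edgeWeight p q e * (V' (G.head e) - V (G.head e)) +
        if e = j then G.weightIncrement p q j * V' (G.head j) else 0) := by
  have hVx := hV x
  have hVx' := hV' x
  by_cases hc : (G.outEdges (G.tail j)).card = 1
  · rw [double, if_pos hc] at hVx'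
    by_cases hxj : G.tail j = x
    · have hcx := hc
      rw [hxj] at hcx
      obtain ⟨i, hi⟩ := Finset.card_eq_one.1 hcx
      have hij : j = i := by
        have : j ∈ G.outEdges x := mem_outEdges.2 hxj
        rwa [hi, Finset.mem_singleton] at this
      subst hij
      have hcard : ((G.parallel j).outEdges x).card = 2 := by
        rw [card_outEdges_parallel, hcx, if_pos hxj]
      have hne : (G.parallel j).outEdges x ≠ ∅ := by
        intro h; simp [h] at hcard
      rw [if_neg hne, hcard, sum_outEdges_parallel, if_pos hxj, hi, Finset.sum_singleton] at hVx'
      have hw1 : (G.parallel j).edgeWeight p q j.castSucc = q := by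
        rw [edgeWeight, if_neg]
        simp [hxj, hcard]
      have hw2 : (G.parallel j).edgeWeight p q (Fin.last n) = q := by
        rw [edgeWeight, if_neg]
        simp [hxj, hcard]
      rw [hw1, hw2] at hVx'
      have hh1 : (G.parallel j).head j.castSucc = G.head j := by simp
      have hh2 : (G.parallel j).head (Fin.last n) = G.head j := by simp
      -- The two parallel `q`-edges are each taken with probability one half, so they act as a
      -- single edge of weight `q`.
      rw [hh1, hh2, ← two_smul ℝ, smul_smul] at hVx'
      norm_num at hVx'
      rw [hi] at hVx
      simp [edgeWeight, hc] at hVx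
      rw [hVx, hVx', hi]
      simp [edgeWeight, weightIncrement, hc]
      ring
    · have hcx : ((G.parallel j).outEdges x).card = (G.outEdges x).card := by
        rw [card_outEdges_parallel, if_neg hxj, add_zero]
      have he : (G.parallel j).outEdges x = ∅ ↔ G.outEdges x = ∅ := by
        rw [← Finset.card_eq_zero, hcx, Finset.card_eq_zero]
      rw [hVx, hVx']
      simp only [he, hcx, sum_outEdges_parallel, if_neg hxj, add_zero]
      split_ifs with h0
      · simp [h0]
      · rw [← smul_sub, ← Finset.sum_sub_distrib]
        congr 1
        refine Finset.sum_congr rfl fun e hee => ?_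
        have htx := mem_outEdges.1 hee
        have hej : e ≠ j := by rintro rfl; exact hxj htx
        have hw : (G.parallel j).edgeWeight p q e.castSucc = G.edgeWeight p q e := by
          rw [edgeWeight, parallel_tail_castSucc, htx, hcx, edgeWeight, htx]
        rw [hw, if_neg hej]
        simp
        ring
  · rw [double, if_neg hc] at hVx'
    have hcx : ((G.serial j).outEdges x).card = (G.outEdges x).card := by
      rw [card_outEdges_serial, if_neg (Ne.symm hx), add_zero]
    have he : (G.serial j).outEdges x = ∅ ↔ G.outEdges x = ∅ := by
      rw [← Finset.card_eq_zero, hcx, Finset.card_eq_zero]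
    -- The new vertex has a single outgoing edge, so passing through it contributes exactly one
    -- factor `p`.
    have hz : V' (n + 1) = p * V' (G.head j) := by
      have h := hV' (n + 1)
      rw [double, if_neg hc] at h
      have hcz : ((G.serial j).outEdges (n + 1)).card = 1 := by
        rw [card_outEdges_serial, hG.outEdges_new]; simp
      have hne : (G.serial j).outEdges (n + 1) ≠ ∅ := by
        intro h; simp [h] at hcz
      rw [if_neg hne, hcz, sum_outEdges_serial, hG.outEdges_new] at h
      have ht : (G.serial j).tail (Fin.last n) = n + 1 := by simp
      have hh : (G.serial j).head (Fin.last n) = G.head j := by simp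
      rw [edgeWeight, ht, hh, hcz] at h
      simpa using h
    rw [hVx, hVx']
    simp only [he, hcx, sum_outEdges_serial, if_neg (Ne.symm hx), add_zero]
    split_ifs with h0
    · simp [h0]
    · rw [← smul_sub, ← Finset.sum_sub_distrib]
      congr 1
      refine Finset.sum_congr rfl fun e hee => ?_
      have htx := mem_outEdges.1 hee
      have hw : (G.serial j).edgeWeight p q e.castSucc = G.edgeWeight p q e := by
        rw [edgeWeight, serial_tail_castSucc, htx, hcx, edgeWeight, htx]
      rw [hw]
      by_cases hej : e = j
      · subst hej
        have hh : (G.serial e).head e.castSucc = n + 1 := by simp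
        rw [hh, hz]
        simp [edgeWeight, weightIncrement, hc]
        ring
      · have hh : (G.serial j).head e.castSucc = G.head e := by simp [hej]
        rw [hh, if_neg hej]
        ring

/-- A walk from a vertex below the tail of `j` can never use `j`. -/
theorem IsHeight.value_double_eq {G : Network n} (hG : G.Admissible) {η : ℕ → ℕ}
    (hη : G.IsHeight η) {p q : A} {V V' : ℕ → A} (hV : G.IsValue p q V) {j : Fin n}
    (hV' : (G.double j).IsValue p q V') {x : ℕ} (hx : x ≠ n + 1) (hxj : η x < η (G.tail j)) :
    V' x = V x := by
  induction hm : η x using Nat.strong_induction_on generalizing x with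
  | _ m ih =>
    rw [← sub_eq_zero, hV.sub_double hG hV' hx]
    rw [Finset.sum_eq_zero, smul_zero]
    intro e he
    have htx := mem_outEdges.1 he
    have hlt := hη.lt e
    have hle := hG.head_le e
    rw [htx] at hlt
    have hej : e ≠ j := by rintro rfl; rw [htx] at hxj; omega
    rw [ih _ (hm ▸ hlt) (by omega) (by omega) rfl, if_neg hej]
    simp

/-- The Leibniz rule for `D` on the harmonic equation matches `IsValue.sub_double` summed over `j`,
by induction on the height. For a fixed first edge `e` only `j = e` changes its weight, and that
doubling leaves the value at the head of `e` untouched. -/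
theorem IsHeight.derivation_value {G : Network n} (hG : G.Admissible) {η : ℕ → ℕ}
    (hη : G.IsHeight η) {p q : A} {V : ℕ → A} {V' : Fin n → ℕ → A} (hV : G.IsValue p q V)
    (hV' : ∀ j, (G.double j).IsValue p q (V' j)) (D : Derivation ℝ A A) (hp : D p = q - p)
    (hq : D q = p * q - q) {x : ℕ} (hx : x ≠ n + 1) : D (V x) = ∑ j, (V' j x - V x) := by
  induction hm : η x using Nat.strong_induction_on generalizing x with
  | _ m ih =>
    have hD : D (V x) = ((G.outEdges x).card : ℝ)⁻¹ • ∑ e ∈ G.outEdges x,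
        (G.edgeWeight p q e * D (V (G.head e)) + G.weightIncrement p q e * V (G.head e)) := by
      have hw : ∀ e, D (G.edgeWeight p q e) = G.weightIncrement p q e := by
        intro e
        unfold edgeWeight weightIncrement
        split_ifs
        exacts [hp, hq]
      conv_lhs => rw [hV x]
      split_ifs with h0
      · simp [h0]
      · rw [D.map_smul, map_sum]
        congr 1
        refine Finset.sum_congr rfl fun e _ => ?_
        rw [D.leibniz, hw, smul_eq_mul, smul_eq_mul, mul_comm (V _)]
    rw [hD, Finset.sum_congr rfl fun j _ => hV.sub_double hG (hV' j) hx, ← Finset.smul_sum,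
      Finset.sum_comm]
    congr 1
    refine Finset.sum_congr rfl fun e he => ?_
    have htx := mem_outEdges.1 he
    have hlt := hη.lt e
    have hle := hG.head_le e
    have hlt' := hlt
    rw [htx] at hlt'
    rw [Finset.sum_add_distrib, Finset.sum_ite_eq, if_pos (Finset.mem_univ _), ← Finset.mul_sum,
      ih _ (hm ▸ hlt') (by omega) rfl, hη.value_double_eq hG hV (hV' e) (by omega) hlt]

/-- The generating element of the path from the source to the sink. -/
def pathValue (G : Network n) (p q : A) : A := G.pathSum p q n source

theorem Admissible.derivation_pathValue {G : Network n} (hG : G.Admissible) {p q : A}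
    (D : Derivation ℝ A A) (hp : D p = q - p) (hq : D q = p * q - q) :
    D (G.pathValue p q) = ∑ j, ((G.double j).pathValue p q - G.pathValue p q) := by
  obtain ⟨η, hη, hs⟩ := hG.exists_height
  choose θ hθ hsθ using fun j => (hG.double j).exists_height
  have := hη.derivation_value hG (hη.isValue p q) (fun j => (hθ j).isValue p q) D hp hq
    (x := source) (by simp [source])
  simp only [pathValue]
  simp only [hη.pathSum_eq p q hs, fun j => (hθ j).pathSum_eq p q (hsθ j)]
  exact this

theorem pathValue_single (p q : A) : single.pathValue p q = p := by
  have h : single.outEdges source = Finset.univ := by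
    ext e; simp [outEdges, single]
  have h0 : source ≠ Network.sink := by simp [source, Network.sink]
  have h1 : single.edgeWeight p q 0 = p := by
    rw [edgeWeight, show single.tail 0 = source from rfl, h]; simp
  simp [pathValue, pathSum, h, h0, h1]

end PathSum

end Network

namespace Network

/-! ### Generating series of growth histories -/

section Growth

open PowerSeries

variable {R : Type*} [CommRing R] [Algebra ℝ R]

/-- Coefficients of the solution of `(1 - z) f' = a`, `a' = a f`, `f(0) = a(0) = u`. -/
def growth (u : R) : ℕ → R × R
  | 0 => (u, u)
  | k + 1 => (((k : ℝ) + 1)⁻¹ • ∑ i : Fin (k + 1), (growth u i).2,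
      ((k : ℝ) + 1)⁻¹ • ∑ i : Fin (k + 1), (growth u i).2 * (growth u (k - i)).1)

theorem growth_zero (u : R) : growth u 0 = (u, u) := by rw [growth]

theorem growth_succ_fst (u : R) (k : ℕ) : ((k : ℝ) + 1) • (growth u (k + 1)).1 =
    ∑ i ∈ Finset.range (k + 1), (growth u i).2 := by
  rw [growth, smul_smul, mul_inv_cancel₀ (by positivity), one_smul,
    Finset.sum_range fun i => (growth u i).2]

theorem growth_succ_snd (u : R) (k : ℕ) : ((k : ℝ) + 1) • (growth u (k + 1)).2 =
    ∑ i ∈ Finset.range (k + 1), (growth u i).2 * (growth u (k - i)).1 := by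
  rw [growth, smul_smul, mul_inv_cancel₀ (by positivity), one_smul,
    Finset.sum_range fun i => (growth u i).2 * (growth u (k - i)).1]

/-- Generating series of the path through a fresh edge. -/
def freshSeries (u : R) : R⟦X⟧ := PowerSeries.mk fun k => (growth u k).1

/-- Generating series of the path through an edge with a doubled tail. -/
def doubledSeries (u : R) : R⟦X⟧ := PowerSeries.mk fun k => (growth u k).2

/-- The geometric series `1 / (1 - z)`. -/
def geomSeries (R : Type*) [CommRing R] : R⟦X⟧ := PowerSeries.mk 1

theorem geomSeries_mul {R : Type*} [CommRing R] : geomSeries R * (1 - X) = 1 :=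
  mk_one_mul_one_sub_eq_one R

theorem natCast_succ_smul (k : ℕ) (x : R) : ((k : ℝ) + 1) • x = x * ((k : R) + 1) := by
  rw [Algebra.smul_def, mul_comm]; simp

theorem derivative_freshSeries (u : R) :
    derivative R (freshSeries u) = geomSeries R * doubledSeries u := by
  ext k
  rw [coeff_derivative, freshSeries, coeff_mk, ← natCast_succ_smul, growth_succ_fst, mul_comm,
    coeff_mul, Finset.Nat.sum_antidiagonal_eq_sum_range_succ_mk]
  simp [doubledSeries, geomSeries]

theorem derivative_doubledSeries (u : R) :
    derivative R (doubledSeries u) = doubledSeries u * freshSeries u := by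
  ext k
  rw [coeff_derivative, doubledSeries, coeff_mk, ← natCast_succ_smul, growth_succ_snd,
    coeff_mul, Finset.Nat.sum_antidiagonal_eq_sum_range_succ_mk]
  simp [freshSeries]

theorem derivative_geomSeries {R : Type*} [CommRing R] :
    derivative R (geomSeries R) = geomSeries R ^ 2 := by
  have h := congrArg (derivative R) (geomSeries_mul (R := R))
  rw [Derivation.leibniz, map_sub, derivative_one, derivative_X] at h
  simp only [smul_eq_mul] at h
  linear_combination (geomSeries R) * h - (derivative R (geomSeries R)) * geomSeries_mul (R := R)

/-- The generating series of the future of the random path in a growing network. -/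
def futureSeries {n : ℕ} (G : Network n) (u : R) : R⟦X⟧ :=
  geomSeries R ^ n * G.pathValue ((1 - X) * freshSeries u) ((1 - X) * doubledSeries u)

/-- The derivation used is `(1 - X) d/dX`. It yields the sum over doublings minus `n` times the
value itself; the derivative of the factor `(1 - X) ^ (-n)` cancels exactly this last term. -/
theorem Admissible.derivative_futureSeries {n : ℕ} {G : Network n} (hG : G.Admissible) (u : R) :
    derivative R (G.futureSeries u) = ∑ j, (G.double j).futureSeries u := by
  have hg := geomSeries_mul (R := R)
  set p := (1 - X) * freshSeries u with hp
  set q := (1 - X) * doubledSeries u with hq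
  have hDp : derivative R p = -freshSeries u + doubledSeries u := by
    rw [hp, Derivation.leibniz, derivative_freshSeries, map_sub, derivative_one, derivative_X]
    simp only [smul_eq_mul]
    linear_combination doubledSeries u * hg
  have hDq : derivative R q = -doubledSeries u + p * doubledSeries u := by
    rw [hq, Derivation.leibniz, derivative_doubledSeries, map_sub, derivative_one, derivative_X]
    simp only [smul_eq_mul]
    ring
  have h := hG.derivation_pathValue (p := p) (q := q)
    ((1 - X : R⟦X⟧) • (derivative R).restrictScalars ℝ)
    (by simp only [Derivation.smul_apply, Derivation.restrictScalars_apply, hDp, smul_eq_mul]; ring)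
    (by simp only [Derivation.smul_apply, Derivation.restrictScalars_apply, hDq, smul_eq_mul]; ring)
  simp only [Derivation.smul_apply, Derivation.restrictScalars_apply, smul_eq_mul,
    Finset.sum_sub_distrib, Finset.sum_const, Finset.card_univ, Fintype.card_fin,
    nsmul_eq_mul] at h
  simp only [futureSeries, ← hp, ← hq]
  rw [← Finset.mul_sum, Derivation.leibniz, Derivation.leibniz_pow, derivative_geomSeries]
  cases n with
  | zero => simp at h ⊢; linear_combination geomSeries R * h - derivative R (G.pathValue p q) * hg
  | succ n =>
    simp only [smul_eq_mul, nsmul_eq_mul, Nat.add_sub_cancel]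
    linear_combination geomSeries R ^ (n + 2) * h -
      geomSeries R ^ (n + 1) * derivative R (G.pathValue p q) * hg

theorem Admissible.coeff_futureSeries {n : ℕ} {G : Network n} (hG : G.Admissible) (u : R) (k : ℕ) :
    ((k : ℝ) + 1) • coeff (k + 1) (G.futureSeries u) =
      ∑ j, coeff k ((G.double j).futureSeries u) := by
  rw [natCast_succ_smul, ← coeff_derivative, hG.derivative_futureSeries, map_sum]

theorem futureSeries_single (u : R) : single.futureSeries u = freshSeries u := by
  rw [futureSeries, pathValue_single]
  linear_combination freshSeries u * geomSeries_mul (R := R)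

/-- At `z = 0` both weights equal `u`, so the distinction by out-degree disappears and every step
counts `u`. -/
theorem coeff_zero_futureSeries {n : ℕ} (G : Network n) (u : R) :
    coeff 0 (G.futureSeries u) = G.pathValue u u := by
  let φ : R⟦X⟧ →ₐ[ℝ] R :=
    { (constantCoeff : R⟦X⟧ →+* R) with
      commutes' := fun r => by
        simp [IsScalarTower.algebraMap_apply ℝ R R⟦X⟧] }
  have hφ : ∀ x, φ x = constantCoeff x := fun _ => rfl
  rw [futureSeries, coeff_zero_eq_constantCoeff_apply, map_mul, ← hφ (pathValue _ _ _), pathValue,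
    map_pathSum]
  simp only [hφ, map_mul, pathValue]
  simp [freshSeries, doubledSeries, geomSeries, growth_zero]

end Growth

/-! ### From generating series to moments of the path length -/

section Expectation

open PowerSeries ENNReal

/-- The expectation of a function with values in `[0, ∞]`. -/
def lexp {α : Type*} (P : PMF α) (g : α → ℝ≥0∞) : ℝ≥0∞ := ∑' a, P a * g a

theorem lexp_pure {α : Type*} (a : α) (g : α → ℝ≥0∞) : lexp (PMF.pure a) g = g a := by
  rw [lexp, tsum_eq_single a]
  · simp
  · intro b hb; simp [hb]

theorem lexp_bind {α β : Type*} (P : PMF α) (Q : α → PMF β) (g : β → ℝ≥0∞) :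
    lexp (P.bind Q) g = lexp P fun a => lexp (Q a) g := by
  simp only [lexp, PMF.bind_apply, ← ENNReal.tsum_mul_left, ← ENNReal.tsum_mul_right]
  rw [ENNReal.tsum_comm]
  simp only [mul_assoc]

theorem lexp_map {α β : Type*} (P : PMF α) (φ : α → β) (g : β → ℝ≥0∞) :
    lexp (P.map φ) g = lexp P (g ∘ φ) := by
  simp only [← PMF.bind_pure_comp, lexp_bind, Function.comp_def, lexp_pure]

theorem lexp_uniformOfFinset {α : Type*} (s : Finset α) (hs : s.Nonempty) (g : α → ℝ≥0∞) :
    lexp (PMF.uniformOfFinset s hs) g = (s.card : ℝ≥0∞)⁻¹ * ∑ a ∈ s, g a := by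
  rw [lexp, tsum_eq_sum (s := s), Finset.mul_sum]
  · refine Finset.sum_congr rfl fun a ha => ?_
    rw [PMF.uniformOfFinset_apply_of_mem hs ha]
  · intro a ha
    rw [PMF.uniformOfFinset_apply_of_notMem hs ha, zero_mul]

theorem lexp_congr {α : Type*} {P : PMF α} {g h : α → ℝ≥0∞} (H : ∀ a ∈ P.support, g a = h a) :
    lexp P g = lexp P h := by
  refine tsum_congr fun a => ?_
  by_cases ha : a ∈ P.support
  · rw [H a ha]
  · rw [(PMF.apply_eq_zero_iff P a).2 ha, zero_mul, zero_mul]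

theorem lexp_sum {α ι : Type*} (P : PMF α) (s : Finset ι) (g : ι → α → ℝ≥0∞) :
    lexp P (fun a => ∑ i ∈ s, g i a) = ∑ i ∈ s, lexp P (g i) := by
  simp only [lexp, Finset.mul_sum]
  exact Summable.tsum_finsetSum fun _ _ => ENNReal.summable

theorem lexp_const_mul {α : Type*} (P : PMF α) (c : ℝ≥0∞) (g : α → ℝ≥0∞) :
    lexp P (fun a => c * g a) = c * lexp P g := by
  simp only [lexp, ← ENNReal.tsum_mul_left]
  exact tsum_congr fun a => by ring

/-- All coefficients are nonnegative. -/
def NonnegCoeffs (x : ℝ⟦X⟧) : Prop := ∀ r, 0 ≤ coeff r x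

theorem nonnegCoeffs_exp : NonnegCoeffs (PowerSeries.exp ℝ) := fun r => by
  rw [coeff_exp]; simp

theorem nonnegCoeffs_one : NonnegCoeffs 1 := fun r => by
  rw [coeff_one]; split_ifs <;> norm_num

theorem NonnegCoeffs.mul {x y : ℝ⟦X⟧} (hx : NonnegCoeffs x) (hy : NonnegCoeffs y) :
    NonnegCoeffs (x * y) := fun r => by
  rw [coeff_mul]
  exact Finset.sum_nonneg fun i _ => mul_nonneg (hx _) (hy _)

theorem NonnegCoeffs.sum {ι : Type*} {s : Finset ι} {f : ι → ℝ⟦X⟧}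
    (h : ∀ i ∈ s, NonnegCoeffs (f i)) : NonnegCoeffs (∑ i ∈ s, f i) := fun r => by
  rw [map_sum]
  exact Finset.sum_nonneg fun i hi => h i hi r

theorem NonnegCoeffs.smul {c : ℝ} (hc : 0 ≤ c) {x : ℝ⟦X⟧} (hx : NonnegCoeffs x) :
    NonnegCoeffs (c • x) := fun r => by
  rw [PowerSeries.coeff_smul]
  exact mul_nonneg hc (hx r)

theorem nonnegCoeffs_pathSum {n : ℕ} (G : Network n) (k x : ℕ) :
    NonnegCoeffs (G.pathSum (PowerSeries.exp ℝ) (PowerSeries.exp ℝ) k x) := by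
  induction k generalizing x with
  | zero => exact nonnegCoeffs_one
  | succ k ih =>
    rw [pathSum]
    split_ifs
    · exact nonnegCoeffs_one
    · refine NonnegCoeffs.smul (by positivity) (NonnegCoeffs.sum fun e _ => ?_)
      simp only [edgeWeight, ite_self]
      exact nonnegCoeffs_exp.mul (ih _)

/-- This is the coefficient of `t ^ r` in `exp ((l + 1) t) = exp t * exp (l t)`. -/
theorem ofReal_add_one_pow_div (l r : ℕ) : ENNReal.ofReal (((l + 1 : ℕ) : ℝ) ^ r / r.factorial) =
    ∑ ij ∈ Finset.HasAntidiagonal.antidiagonal r, ENNReal.ofReal ((ij.1.factorial : ℝ)⁻¹) *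
      ENNReal.ofReal ((l : ℝ) ^ ij.2 / ij.2.factorial) := by
  have h : ((l + 1 : ℕ) : ℝ) ^ r / r.factorial = ∑ ij ∈ Finset.HasAntidiagonal.antidiagonal r,
      (ij.1.factorial : ℝ)⁻¹ * ((l : ℝ) ^ ij.2 / ij.2.factorial) := by
    push_cast
    rw [add_comm, (Commute.all (1 : ℝ) (l : ℝ)).add_pow', Finset.sum_div]
    refine Finset.sum_congr rfl fun ij hij => ?_
    obtain rfl := Finset.HasAntidiagonal.mem_antidiagonal.1 hij
    have h1 := Nat.add_choose_mul_factorial_mul_factorial ij.1 ij.2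
    rw [← Nat.choose_symm_add] at h1
    have h2 : (((ij.1 + ij.2).choose ij.1 : ℕ) : ℝ) * ij.1.factorial * ij.2.factorial =
      ((ij.1 + ij.2).factorial : ℕ) := by exact_mod_cast h1
    have h3 : (0 : ℝ) < ij.1.factorial := by positivity
    have h4 : (0 : ℝ) < ij.2.factorial := by positivity
    have h5 : (0 : ℝ) < (ij.1 + ij.2).factorial := by positivity
    rw [one_pow, one_mul, nsmul_eq_mul]
    field_simp
    linear_combination (l : ℝ) ^ ij.2 * h2
  rw [h, ENNReal.ofReal_sum_of_nonneg fun i _ => by positivity]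
  exact Finset.sum_congr rfl fun i _ => ENNReal.ofReal_mul (by positivity)

/-- If every step has weight `exp t`, a path of length `l` has weight `exp (l t)`, so the path sum
is the moment generating series of the walk length. -/
theorem lexp_walkLength {n : ℕ} (G : Network n) (k x r : ℕ) :
    lexp (G.walkLength k x) (fun l => ENNReal.ofReal ((l : ℝ) ^ r / r.factorial)) =
      ENNReal.ofReal (coeff r (G.pathSum (PowerSeries.exp ℝ) (PowerSeries.exp ℝ) k x)) := by
  have h0 (r : ℕ) : lexp (PMF.pure 0) (fun l : ℕ => ENNReal.ofReal ((l : ℝ) ^ r / r.factorial)) =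
      ENNReal.ofReal (coeff r (1 : ℝ⟦X⟧)) := by
    rw [lexp_pure, coeff_one]
    rcases Nat.eq_zero_or_pos r with rfl | hr
    · simp
    · simp [hr.ne']
  induction k generalizing x r with
  | zero => rw [walkLength, pathSum, h0 r]
  | succ k ih =>
    rw [walkLength, pathSum]
    by_cases hx : x = sink
    · rw [if_pos hx, if_pos (Or.inl hx), h0 r]
    · by_cases hne : (G.outEdges x).Nonempty
      · rw [if_neg hx, dif_pos hne, if_neg (by simp [hx, hne.ne_empty]), lexp_bind,
          lexp_uniformOfFinset, PowerSeries.coeff_smul, smul_eq_mul, ENNReal.ofReal_mul (by positivity),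
          ENNReal.ofReal_inv_of_pos (by exact_mod_cast hne.card_pos), ENNReal.ofReal_natCast]
        congr 1
        rw [map_sum, ENNReal.ofReal_sum_of_nonneg]
        · refine Finset.sum_congr rfl fun e _ => ?_
          simp only [lexp_map, Function.comp_def, ofReal_add_one_pow_div, edgeWeight, ite_self,
            lexp_sum, lexp_const_mul]
          rw [coeff_mul, ENNReal.ofReal_sum_of_nonneg]
          · refine Finset.sum_congr rfl fun ij _ => ?_
            rw [ENNReal.ofReal_mul (nonnegCoeffs_exp _), ih, coeff_exp]
            simp
          · intro ij _
            exact mul_nonneg (nonnegCoeffs_exp _) (nonnegCoeffs_pathSum _ _ _ _)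
        · intro e _
          simp only [edgeWeight, ite_self]
          exact nonnegCoeffs_exp.mul (nonnegCoeffs_pathSum _ _ _) r
      · have he := Finset.not_nonempty_iff_eq_empty.1 hne
        rw [if_neg hx, dif_neg hne, if_pos (Or.inr he), h0 r]

/-- Needed because `ENNReal.ofReal` commutes with sums only for nonnegative terms. -/
theorem Admissible.nonneg_coeff_futureSeries {n : ℕ} {G : Network n} (hG : G.Admissible) (k : ℕ) :
    NonnegCoeffs (coeff k (G.futureSeries (PowerSeries.exp ℝ))) := by
  induction k generalizing n with
  | zero => rw [coeff_zero_futureSeries]; exact nonnegCoeffs_pathSum _ _ _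
  | succ k ih =>
    have h : coeff (k + 1) (G.futureSeries (PowerSeries.exp ℝ)) = ((k : ℝ) + 1)⁻¹ •
        ∑ j, coeff k ((G.double j).futureSeries (PowerSeries.exp ℝ)) := by
      rw [← hG.coeff_futureSeries, smul_smul, inv_mul_cancel₀ (by positivity), one_smul]
    rw [h]
    exact NonnegCoeffs.smul (by positivity) (NonnegCoeffs.sum fun j _ => ih (hG.double j))

theorem admissible_of_mem_support {n : ℕ} {G : Network (n + 1)} (hG : G ∈ (binary n).support) :
    G.Admissible := by
  induction n with
  | zero =>
    rw [binary, PMF.support_pure, Set.mem_singleton_iff] at hG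
    rw [hG]; exact admissible_single
  | succ n ih =>
    rw [binary, PMF.mem_support_bind_iff] at hG
    obtain ⟨G', hG', h⟩ := hG
    rw [PMF.mem_support_map_iff] at h
    obtain ⟨j, -, rfl⟩ := h
    exact (ih hG').double j

/-- One more random doubling of a network with `n + 1` edges averages `n + 1` terms whose sum is `k
+ 1` times the next coefficient; the resulting factors `(k + 1) / (n + 1)` accumulate to the
binomial coefficient. Setting `k = 0` gives the law at size `n + 1`. -/
theorem lexp_binary (n k r : ℕ) :
    lexp (binary n) (fun G => ENNReal.ofReal
      (coeff r (coeff k (G.futureSeries (PowerSeries.exp ℝ))))) =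
    ENNReal.ofReal ((n + k).choose n *
      coeff r (coeff (n + k) (freshSeries (PowerSeries.exp ℝ)))) := by
  induction n generalizing k with
  | zero => rw [binary, lexp_pure, futureSeries_single]; simp
  | succ n ih =>
    rw [binary, lexp_bind]
    have : ∀ G ∈ (binary n).support, lexp ((PMF.uniformOfFintype (Fin (n + 1))).map G.double)
        (fun G => ENNReal.ofReal (coeff r (coeff k (G.futureSeries (PowerSeries.exp ℝ))))) =
        ENNReal.ofReal (((k : ℝ) + 1) / ((n : ℝ) + 1)) * ENNReal.ofReal
          (coeff r (coeff (k + 1) (G.futureSeries (PowerSeries.exp ℝ)))) := by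
      intro G hG
      have hA := admissible_of_mem_support hG
      rw [lexp_map, PMF.uniformOfFintype, lexp_uniformOfFinset, Finset.card_univ, Fintype.card_fin,
        ← ENNReal.ofReal_mul (by positivity)]
      simp only [Function.comp_def]
      rw [← ENNReal.ofReal_sum_of_nonneg fun j _ => (hA.double j).nonneg_coeff_futureSeries k r,
        ← map_sum, ← hA.coeff_futureSeries, PowerSeries.coeff_smul, ← ENNReal.ofReal_natCast,
        ← ENNReal.ofReal_inv_of_pos (by positivity), ← ENNReal.ofReal_mul (by positivity)]
      congr 1
      push_cast
      rw [smul_eq_mul]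
      field_simp
    rw [lexp_congr this, lexp_const_mul, ih, ← ENNReal.ofReal_mul (by positivity), ← mul_assoc]
    have hN : n + (k + 1) = n + 1 + k := by omega
    rw [hN]
    congr 2
    have h := Nat.choose_succ_right_eq (n + 1 + k) n
    have h' : ((n + 1 + k).choose (n + 1) : ℝ) * ((n : ℝ) + 1) =
        (n + 1 + k).choose n * ((k : ℝ) + 1) := by
      have : n + 1 + k - n = k + 1 := by omega
      rw [this] at h
      exact_mod_cast h
    field_simp
    linear_combination -h'

theorem lexp_pathLengthLaw (n r : ℕ) :
    lexp (pathLengthLaw (n + 1)) (fun l => ENNReal.ofReal ((l : ℝ) ^ r / r.factorial)) =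
      ENNReal.ofReal (coeff r (growth (PowerSeries.exp ℝ) n).1) := by
  rw [pathLengthLaw, lexp_bind]
  have h := lexp_binary n 0 r
  simp only [coeff_zero_futureSeries] at h
  simp only [pathLength, lexp_walkLength]
  simp only [pathValue] at h
  rw [h]
  simp [freshSeries]

theorem coeff_growth_fst_nonneg (n r : ℕ) : 0 ≤ coeff r (growth (PowerSeries.exp ℝ) n).1 := by
  have := admissible_single.nonneg_coeff_futureSeries n r
  rwa [futureSeries_single, freshSeries, coeff_mk] at this

end Expectation

end Network

open PowerSeries in
/-- The moments of the path length. -/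
theorem integral_pathLengthLaw (n r : ℕ) :
    Integrable (fun l : ℕ => (l : ℝ) ^ r) (pathLengthLaw (n + 1)).toMeasure ∧
    ∫ l : ℕ, (l : ℝ) ^ r ∂(pathLengthLaw (n + 1)).toMeasure =
      r.factorial * coeff r (Network.growth (PowerSeries.exp ℝ) n).1 := by
  have hl : ∫⁻ l : ℕ, ENNReal.ofReal ((l : ℝ) ^ r / r.factorial) ∂(pathLengthLaw (n + 1)).toMeasure
      = ENNReal.ofReal (coeff r (Network.growth (PowerSeries.exp ℝ) n).1) := by
    rw [← Network.lexp_pathLengthLaw, lintegral_countable', Network.lexp]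
    refine tsum_congr fun l => ?_
    rw [PMF.toMeasure_apply_singleton _ _ (measurableSet_singleton l), mul_comm]
  have hi : Integrable (fun l : ℕ => (l : ℝ) ^ r / r.factorial)
      (pathLengthLaw (n + 1)).toMeasure := by
    refine ⟨measurable_from_nat.aestronglyMeasurable, ?_⟩
    rw [hasFiniteIntegral_iff_ofReal (ae_of_all _ fun l => by positivity), hl]
    exact ENNReal.ofReal_lt_top
  have hv : ∫ l : ℕ, (l : ℝ) ^ r / r.factorial ∂(pathLengthLaw (n + 1)).toMeasure =
      coeff r (Network.growth (PowerSeries.exp ℝ) n).1 := by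
    rw [integral_eq_lintegral_of_nonneg_ae (ae_of_all _ fun l => by positivity)
      hi.aestronglyMeasurable, hl, ENNReal.toReal_ofReal (Network.coeff_growth_fst_nonneg n r)]
  have hf : (r.factorial : ℝ) ≠ 0 := by positivity
  constructor
  · have := hi.mul_const (r.factorial : ℝ)
    simpa [div_mul_cancel₀ _ hf] using this
  · rw [← hv, integral_div, mul_div_cancel₀ _ hf]

/-! ### Coefficients of `(1 - z) ^ (-(α + 1))`: identities, growth and convolutions -/

/-- The `k`-th coefficient of `(1 - z) ^ (-(α + 1))`. -/
def ascBinom (α : ℝ) (k : ℕ) : ℝ := ∏ i ∈ Finset.range k, (α + 1 + i) / (i + 1)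

@[simp]
theorem ascBinom_zero (α : ℝ) : ascBinom α 0 = 1 := by simp [ascBinom]

theorem succ_mul_ascBinom_succ (α : ℝ) (k : ℕ) :
    ((k : ℝ) + 1) * ascBinom α (k + 1) = (α + 1 + k) * ascBinom α k := by
  have : (k : ℝ) + 1 ≠ 0 := by positivity
  rw [ascBinom, Finset.prod_range_succ, ← ascBinom]
  field_simp

/-- The coefficient form of `d/dz (1 - z) ^ (-(α + 1)) = (α + 1) (1 - z) ^ (-(α + 2))`. -/
theorem succ_mul_ascBinom_succ' (α : ℝ) (k : ℕ) :
    ((k : ℝ) + 1) * ascBinom α (k + 1) = (α + 1) * ascBinom (α + 1) k := by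
  induction k with
  | zero => simp [ascBinom]
  | succ k ih =>
    have h : (k : ℝ) + 1 ≠ 0 := by positivity
    have h1 := succ_mul_ascBinom_succ α (k + 1)
    have h2 := succ_mul_ascBinom_succ (α + 1) k
    apply mul_left_cancel₀ h
    push_cast at h1 ⊢
    linear_combination ((k : ℝ) + 1) * h1 + (α + 1 + (k + 1)) * ih - (α + 1) * h2

theorem sum_ascBinom (α : ℝ) (k : ℕ) :
    ∑ i ∈ Finset.range (k + 1), ascBinom α i = ascBinom (α + 1) k := by
  induction k with
  | zero => simp
  | succ k ih =>
    have h : (k : ℝ) + 1 ≠ 0 := by positivity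
    rw [Finset.sum_range_succ, ih]
    apply mul_left_cancel₀ h
    linear_combination succ_mul_ascBinom_succ' α k - succ_mul_ascBinom_succ (α + 1) k

theorem succ_mul_ascBinom_eq_sum (α : ℝ) (k : ℕ) :
    ((k : ℝ) + 1) * ascBinom α (k + 1) = (α + 1) * ∑ i ∈ Finset.range (k + 1), ascBinom α i := by
  rw [sum_ascBinom, succ_mul_ascBinom_succ']

/-- The Cauchy product of two sequences. -/
def conv (u v : ℕ → ℝ) (k : ℕ) : ℝ := ∑ i ∈ Finset.range (k + 1), u i * v (k - i)

theorem conv_eq_sum_antidiagonal (u v : ℕ → ℝ) (k : ℕ) :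
    conv u v k = ∑ ij ∈ Finset.HasAntidiagonal.antidiagonal k, u ij.1 * v ij.2 := by
  rw [Finset.Nat.sum_antidiagonal_eq_sum_range_succ_mk, conv]

theorem conv_comm (u v : ℕ → ℝ) (k : ℕ) : conv u v k = conv v u k := by
  rw [conv_eq_sum_antidiagonal, conv_eq_sum_antidiagonal, ← Finset.Nat.sum_antidiagonal_swap]
  exact Finset.sum_congr rfl fun _ _ => mul_comm _ _

/-- The exponents of `1 - z` add up. The proof differentiates the product: the factor `k + 1` splits
as the sum of the two indices, one for each factor. -/
theorem conv_ascBinom (α β : ℝ) (k : ℕ) :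
    conv (ascBinom α) (ascBinom β) k = ascBinom (α + β + 1) k := by
  induction k generalizing α β with
  | zero => simp [conv]
  | succ k ih =>
    have h : (k : ℝ) + 1 ≠ 0 := by positivity
    apply mul_left_cancel₀ h
    have h1 : ((k : ℝ) + 1) * conv (ascBinom α) (ascBinom β) (k + 1) =
        ∑ ij ∈ Finset.HasAntidiagonal.antidiagonal (k + 1),
          (ij.1 : ℝ) * (ascBinom α ij.1 * ascBinom β ij.2) +
        ∑ ij ∈ Finset.HasAntidiagonal.antidiagonal (k + 1),
          (ij.2 : ℝ) * (ascBinom α ij.1 * ascBinom β ij.2) := by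
      rw [conv_eq_sum_antidiagonal, Finset.mul_sum, ← Finset.sum_add_distrib]
      refine Finset.sum_congr rfl fun ij hij => ?_
      have : (ij.1 : ℝ) + ij.2 = (k : ℝ) + 1 := by
        exact_mod_cast Finset.HasAntidiagonal.mem_antidiagonal.1 hij
      rw [← this]
      ring
    rw [h1, Finset.Nat.sum_antidiagonal_succ, Finset.Nat.sum_antidiagonal_succ']
    have h2 : ∑ ij ∈ Finset.HasAntidiagonal.antidiagonal k, (((ij.1 + 1 : ℕ) : ℝ) *
        (ascBinom α (ij.1 + 1) * ascBinom β ij.2)) = (α + 1) * ascBinom (α + β + 2) k := by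
      rw [show α + β + 2 = (α + 1) + β + 1 by ring, ← ih, conv_eq_sum_antidiagonal, Finset.mul_sum]
      refine Finset.sum_congr rfl fun ij _ => ?_
      push_cast
      linear_combination ascBinom β ij.2 * succ_mul_ascBinom_succ' α ij.1
    have h3 : ∑ ij ∈ Finset.HasAntidiagonal.antidiagonal k, (((ij.2 + 1 : ℕ) : ℝ) *
        (ascBinom α ij.1 * ascBinom β (ij.2 + 1))) = (β + 1) * ascBinom (α + β + 2) k := by
      rw [show α + β + 2 = α + (β + 1) + 1 by ring, ← ih, conv_eq_sum_antidiagonal, Finset.mul_sum]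
      refine Finset.sum_congr rfl fun ij _ => ?_
      push_cast
      linear_combination ascBinom α ij.1 * succ_mul_ascBinom_succ' β ij.2
    have h4 := succ_mul_ascBinom_succ' (α + β + 1) k
    rw [show α + β + 1 + 1 = α + β + 2 by ring] at h4
    simp only [Nat.cast_zero, zero_mul, zero_add]
    rw [h2, h3, h4]
    ring

theorem ascBinom_pos {α : ℝ} (hα : 0 ≤ α) (k : ℕ) : 0 < ascBinom α k :=
  Finset.prod_pos fun i _ => by positivity

theorem monotone_ascBinom {α : ℝ} (hα : 0 ≤ α) : Monotone (ascBinom α) := by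
  refine monotone_nat_of_le_succ fun k => ?_
  have h := succ_mul_ascBinom_succ α k
  have := ascBinom_pos hα k
  have : (0 : ℝ) < (k : ℝ) + 1 := by positivity
  nlinarith [mul_nonneg hα (ascBinom_pos hα k).le]

/-- Up to the factor `k / (k + α + 1)`, the quotient is the reciprocal of Euler's product for the
Gamma function. -/
theorem tendsto_ascBinom_div_rpow {α : ℝ} (hα : Real.Gamma (α + 1) ≠ 0) :
    Tendsto (fun k : ℕ => ascBinom α k / (k : ℝ) ^ α) atTop (𝓝 (Real.Gamma (α + 1))⁻¹) := by
  have h1 := (Real.GammaSeq_tendsto_Gamma (α + 1)).inv₀ hα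
  have h2 : Tendsto (fun k : ℕ => (k : ℝ) / (k + (α + 1))) atTop (𝓝 1) :=
    tendsto_natCast_div_add_atTop (α + 1)
  have h3 := h1.mul h2
  rw [mul_one] at h3
  refine h3.congr' ?_
  obtain ⟨N, hN⟩ := exists_nat_gt (-(α + 1))
  filter_upwards [eventually_ge_atTop (N + 1)] with k hk
  have hk0 : (0 : ℝ) < k := by exact_mod_cast (by omega : 0 < k)
  have hkN : (N : ℝ) ≤ k := by exact_mod_cast (by omega : N ≤ k)
  have hne : (k : ℝ) + (α + 1) ≠ 0 := by linarith
  rw [Real.GammaSeq, Real.rpow_add_one hk0.ne', Finset.prod_range_succ, ascBinom,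
    Finset.prod_div_distrib]
  have hf : ∏ i ∈ Finset.range k, ((i : ℝ) + 1) = (k.factorial : ℝ) := by
    exact_mod_cast Finset.prod_range_add_one_eq_factorial k
  rw [hf]
  have hf0 : (k.factorial : ℝ) ≠ 0 := by positivity
  have hp : (k : ℝ) ^ α ≠ 0 := by positivity
  have hne' : α + 1 + (k : ℝ) ≠ 0 := by linarith
  rw [add_comm (k : ℝ) (α + 1)]
  field_simp

theorem isBigO_ascBinom_rpow {α : ℝ} (hα : Real.Gamma (α + 1) ≠ 0) :
    ascBinom α =O[atTop] fun k : ℕ => (k : ℝ) ^ α := by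
  refine isBigO_of_div_tendsto_nhds ?_ _ (tendsto_ascBinom_div_rpow hα)
  filter_upwards [eventually_gt_atTop 0] with k hk h
  have : (0 : ℝ) < k := by exact_mod_cast hk
  exact absurd h (by positivity)

theorem Gamma_add_one_ne_zero {α : ℝ} (hα : 0 ≤ α) : Real.Gamma (α + 1) ≠ 0 :=
  (Real.Gamma_pos_of_pos (by linarith)).ne'

theorem isLittleO_ascBinom {α β : ℝ} (hα : Real.Gamma (α + 1) ≠ 0) (hβ : 0 ≤ β) (h : α < β) :
    ascBinom α =o[atTop] ascBinom β := by
  have h1 : (fun k : ℕ => (k : ℝ) ^ α) =o[atTop] fun k : ℕ => (k : ℝ) ^ β := by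
    refine isLittleO_of_tendsto' ?_ ?_
    · filter_upwards [eventually_gt_atTop 0] with k hk h
      have : (0 : ℝ) < k := by exact_mod_cast hk
      exact absurd h (by positivity)
    · refine ((tendsto_rpow_neg_atTop (sub_pos.2 h)).comp tendsto_natCast_atTop_atTop).congr' ?_
      filter_upwards [eventually_gt_atTop 0] with k hk
      have : (0 : ℝ) < k := by exact_mod_cast hk
      rw [Function.comp_apply, ← Real.rpow_sub this, neg_sub]
  have h2 : (fun k : ℕ => (k : ℝ) ^ β) =O[atTop] ascBinom β := by
    have hG := Gamma_add_one_ne_zero hβ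
    have ht := (tendsto_ascBinom_div_rpow hG).inv₀ (inv_ne_zero hG)
    refine isBigO_of_div_tendsto_nhds (.of_forall fun k hk => absurd hk (ascBinom_pos hβ k).ne')
      (Real.Gamma (β + 1))⁻¹⁻¹ (ht.congr fun k => ?_)
    simp
  exact ((isBigO_ascBinom_rpow hα).trans_isLittleO h1).trans_isBigO h2

theorem exists_forall_abs_le {β : ℝ} (hβ : 0 ≤ β) {v : ℕ → ℝ} (hv : v =O[atTop] ascBinom β) :
    ∃ D, 0 < D ∧ ∀ k, |v k| ≤ D * ascBinom β k := by
  rw [← Nat.cofinite_eq_atTop] at hv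
  obtain ⟨D, hD, h⟩ := bound_of_isBigO_cofinite hv
  refine ⟨D, hD, fun k => ?_⟩
  have := h (x := k) (ascBinom_pos hβ k).ne'
  rwa [Real.norm_eq_abs, Real.norm_eq_abs, abs_of_pos (ascBinom_pos hβ k)] at this

theorem isLittleO_conv {α β : ℝ} (hα : 0 ≤ α) (hβ : 0 ≤ β) {u v : ℕ → ℝ}
    (hu : u =o[atTop] ascBinom α) (hv : v =O[atTop] ascBinom β) :
    conv u v =o[atTop] ascBinom (α + β + 1) := by
  obtain ⟨D, hD, hvD⟩ := exists_forall_abs_le hβ hv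
  have hγ : 0 ≤ α + β + 1 := by linarith
  rw [isLittleO_iff]
  intro ε hε
  have hε' : 0 < ε / (2 * D) := by positivity
  obtain ⟨N, hN⟩ := eventually_atTop.1 (isLittleO_iff.1 hu hε')
  set C := ∑ i ∈ Finset.range N, |u i| with hC
  have hC0 : 0 ≤ C := Finset.sum_nonneg fun _ _ => abs_nonneg _
  have hb := isLittleO_iff.1 (isLittleO_ascBinom (Gamma_add_one_ne_zero hβ) hγ
    (by linarith : β < α + β + 1)) (show 0 < ε / (2 * (C * D + 1)) by positivity)
  filter_upwards [hb, eventually_ge_atTop N] with k hk hkN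
  rw [Real.norm_eq_abs, Real.norm_eq_abs, abs_of_pos (ascBinom_pos hβ k),
    abs_of_pos (ascBinom_pos hγ k)] at hk
  rw [Real.norm_eq_abs, Real.norm_eq_abs, abs_of_pos (ascBinom_pos hγ k)]
  have hbk := ascBinom_pos hβ k
  have hgk := ascBinom_pos hγ k
  -- The sum is split at `N`. Beyond `N` the smallness of `u` is used; the boundedly many earlier
  -- terms are `O(ascBinom β k)`, of lower order since `β < α + β + 1`.
  have h1 : |conv u v k| ≤ ∑ i ∈ Finset.range (k + 1), (ε / 2 * (ascBinom α i * ascBinom β (k - i)) +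
      (if i ∈ Finset.range N then |u i| * (D * ascBinom β k) else 0)) := by
    refine (Finset.abs_sum_le_sum_abs _ _).trans (Finset.sum_le_sum fun i hi => ?_)
    rw [abs_mul]
    have ha := ascBinom_pos hα i
    have hbi := ascBinom_pos hβ (k - i)
    split_ifs with hiN
    · have hm : ascBinom β (k - i) ≤ ascBinom β k := monotone_ascBinom hβ (Nat.sub_le _ _)
      have : |u i| * |v (k - i)| ≤ |u i| * (D * ascBinom β k) :=
        mul_le_mul_of_nonneg_left ((hvD _).trans (by gcongr)) (abs_nonneg _)
      have : 0 ≤ ε / 2 * (ascBinom α i * ascBinom β (k - i)) := by positivity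
      linarith
    · have h := hN i (by simpa using hiN)
      rw [Real.norm_eq_abs, Real.norm_eq_abs, abs_of_pos ha] at h
      calc |u i| * |v (k - i)| ≤ (ε / (2 * D) * ascBinom α i) * (D * ascBinom β (k - i)) :=
            mul_le_mul h (hvD _) (abs_nonneg _) (by positivity)
        _ = ε / 2 * (ascBinom α i * ascBinom β (k - i)) + 0 := by field_simp; ring
  refine h1.trans ?_
  rw [Finset.sum_add_distrib, ← Finset.mul_sum, ← conv, conv_ascBinom, Finset.sum_ite_mem,
    Finset.inter_eq_right.2 (Finset.range_subset_range.2 (by omega)), ← Finset.sum_mul, ← hC]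
  have h2 : C * (D * ascBinom β k) ≤ ε / 2 * ascBinom (α + β + 1) k := by
    calc C * (D * ascBinom β k) = C * D * ascBinom β k := by ring
      _ ≤ (C * D + 1) * ascBinom β k := by gcongr; linarith
      _ ≤ (C * D + 1) * (ε / (2 * (C * D + 1)) * ascBinom (α + β + 1) k) := by gcongr
      _ = ε / 2 * ascBinom (α + β + 1) k := by field_simp
  linarith

/-- The difference is bilinear: the error of `u` convolved with `v`, plus `c` times the error of `v`
convolved with `ascBinom α`. -/
theorem isLittleO_conv_sub {α β c d : ℝ} (hα : 0 ≤ α) (hβ : 0 ≤ β) {u v : ℕ → ℝ}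
    (hu : (fun k => u k - c * ascBinom α k) =o[atTop] ascBinom α)
    (hv : (fun k => v k - d * ascBinom β k) =o[atTop] ascBinom β) :
    (fun k => conv u v k - c * d * ascBinom (α + β + 1) k) =o[atTop] ascBinom (α + β + 1) := by
  have hvO : v =O[atTop] ascBinom β := by
    have := hv.isBigO.add ((isBigO_refl (ascBinom β) atTop).const_mul_left d)
    simpa using this
  have h1 := isLittleO_conv hα hβ hu hvO
  have h2 := (isLittleO_conv hβ hα hv (isBigO_refl (ascBinom α) atTop)).const_mul_left c
  rw [show β + α + 1 = α + β + 1 by ring] at h2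
  refine (h1.add h2).congr_left fun k => ?_
  rw [conv_comm (fun k => v k - d * ascBinom β k), ← conv_ascBinom]
  simp only [conv, Finset.mul_sum]
  rw [← Finset.sum_add_distrib, ← Finset.sum_sub_distrib]
  exact Finset.sum_congr rfl fun i _ => by ring

/-- A sequence that is dominated by a fraction of its weighted means tends to zero. -/
theorem tendsto_zero_of_le_weighted_mean {m w G ε : ℕ → ℝ} {q : ℝ} (hq0 : 0 ≤ q) (hq1 : q < 1)
    (hm : ∀ k, 0 ≤ m k) (hw : ∀ k, 0 < w k)
    (hG : ∀ k, G k = ∑ i ∈ Finset.range (k + 1), w i) (hGt : Tendsto G atTop atTop)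
    (hε : Tendsto ε atTop (𝓝 0))
    (h : ∀ k, m (k + 1) ≤ q * ((∑ i ∈ Finset.range (k + 1), m i * w i) / G k) + ε k) :
    Tendsto m atTop (𝓝 0) := by
  have hGpos : ∀ k, 0 < G k := fun k => by
    rw [hG]; exact Finset.sum_pos (fun i _ => hw i) (by simp)
  obtain ⟨E, hE⟩ := hε.bddAbove_range
  have hE : ∀ k, ε k ≤ E := fun k => hE ⟨k, rfl⟩
  have hq' : 0 < 1 - q := by linarith
  set B := max (m 0) (E / (1 - q)) with hB
  have hB0 : 0 ≤ B := (hm 0).trans (le_max_left _ _)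
  have hEB : E ≤ (1 - q) * B := by
    have := le_max_right (m 0) (E / (1 - q))
    rw [div_le_iff₀ hq'] at this
    linarith
  have hmB : ∀ k, m k ≤ B := by
    intro k
    induction k using Nat.strong_induction_on with
    | _ k ih =>
      cases k with
      | zero => exact le_max_left _ _
      | succ k =>
        have h1 : (∑ i ∈ Finset.range (k + 1), m i * w i) / G k ≤ B := by
          rw [div_le_iff₀ (hGpos k), hG, Finset.mul_sum]
          exact Finset.sum_le_sum fun i hi =>
            mul_le_mul_of_nonneg_right (ih i (Finset.mem_range.1 hi)) (hw i).le
        have h2 := h k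
        have h3 := hE k
        have h4 := mul_le_mul_of_nonneg_left h1 hq0
        linarith
  -- An eventual bound improves by the factor `q`: the initial terms lose their influence on the
  -- mean because the total weight diverges. Iteration drives the bound to zero.
  have step : ∀ b δ, 0 ≤ b → 0 < δ → (∀ᶠ k in atTop, m k ≤ b) → ∀ᶠ k in atTop, m k ≤ q * b + δ := by
    intro b δ hb hδ hmb
    obtain ⟨N, hN⟩ := eventually_atTop.1 hmb
    set C := ∑ i ∈ Finset.range N, B * w i with hC
    have h0 : Tendsto (fun k => q * (C / G k) + ε k) atTop (𝓝 0) := by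
      simpa using ((hGt.const_div_atTop C).const_mul q).add hε
    have h1 : ∀ᶠ k in atTop, m (k + 1) ≤ q * b + δ := by
      filter_upwards [h0.eventually_lt_const hδ, eventually_ge_atTop N] with k hk hkN
      have h2 : (∑ i ∈ Finset.range (k + 1), m i * w i) / G k ≤ b + C / G k := by
        rw [div_le_iff₀ (hGpos k), add_mul, div_mul_cancel₀ _ (hGpos k).ne']
        calc ∑ i ∈ Finset.range (k + 1), m i * w i
            ≤ ∑ i ∈ Finset.range (k + 1), (b * w i +
              if i ∈ Finset.range N then B * w i else 0) := by
              refine Finset.sum_le_sum fun i _ => ?_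
              have hwi := hw i
              split_ifs with hi
              · have := mul_le_mul_of_nonneg_right (hmB i) hwi.le
                have := mul_nonneg hb hwi.le
                linarith
              · have := mul_le_mul_of_nonneg_right (hN i (by simpa using hi)) hwi.le
                linarith
          _ = b * G k + C := by
              rw [Finset.sum_add_distrib, ← Finset.mul_sum, ← hG, Finset.sum_ite_mem,
                Finset.inter_eq_right.2 (Finset.range_subset_range.2 (by omega))]
      have h3 := h k
      have h4 := mul_le_mul_of_nonneg_left h2 hq0
      rw [mul_add] at h4
      linarith
    obtain ⟨M, hM⟩ := eventually_atTop.1 h1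
    filter_upwards [eventually_ge_atTop (M + 1)] with k hk
    obtain ⟨k, rfl⟩ : ∃ k', k = k' + 1 := ⟨k - 1, by omega⟩
    exact hM k (by omega)
  have iter : ∀ δ, 0 < δ → ∀ j : ℕ, ∀ᶠ k in atTop, m k ≤ q ^ j * B + δ := by
    intro δ hδ j
    induction j with
    | zero => exact .of_forall fun k => by have := hmB k; simp; linarith
    | succ j ih =>
      have := step _ ((1 - q) * δ) (by positivity) (by positivity) ih
      filter_upwards [this] with k hk
      calc m k ≤ _ := hk
        _ = _ := by ring
  rw [tendsto_order]
  refine ⟨fun a ha => .of_forall fun k => ha.trans_le (hm k), fun a ha => ?_⟩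
  have hj : Tendsto (fun j : ℕ => q ^ j * B) atTop (𝓝 0) := by
    simpa using (tendsto_pow_atTop_nhds_zero_of_lt_one hq0 hq1).mul_const B
  obtain ⟨j, hj⟩ := (hj.eventually_lt_const (half_pos ha)).exists
  filter_upwards [iter (a / 2) (half_pos ha) j] with k hk
  linarith

/-! ### The golden ratio and the coefficients of the limiting moments -/

theorem phiTilde_sq : phiTilde ^ 2 = 1 - phiTilde := by
  have := Real.sq_sqrt (show (0 : ℝ) ≤ 5 by norm_num)
  rw [phiTilde]
  nlinarith

theorem phiTilde_pos : 0 < phiTilde := by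
  have : (1 : ℝ) < √5 := Real.lt_sqrt_of_sq_lt (by norm_num)
  rw [phiTilde]
  linarith

theorem phiTilde_lt_one : phiTilde < 1 := by
  have := phiTilde_sq
  have := phiTilde_pos
  nlinarith

/-- The coefficients in the moments of the limit law. -/
def momentCoeff : ℕ → ℝ
  | 0 => 1
  | 1 => (3 + phiTilde) / 5
  | r + 2 => 1 / (phiTilde * ((r : ℝ) + 1) * (((r : ℝ) + 3) * phiTilde + 1)) *
      ∑ k : Fin (r + 1), (((k : ℕ) + 1 : ℝ) * phiTilde + 1) * momentCoeff (k + 1) *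
        momentCoeff (r + 1 - k)

theorem momentCoeff_add_two (r : ℕ) : momentCoeff (r + 2) =
    1 / (phiTilde * ((r : ℝ) + 1) * (((r : ℝ) + 3) * phiTilde + 1)) *
      ∑ k ∈ Finset.range (r + 1), (((k : ℕ) + 1 : ℝ) * phiTilde + 1) * momentCoeff (k + 1) *
        momentCoeff (r + 1 - k) := by
  rw [momentCoeff, Finset.sum_range fun k => (((k : ℕ) + 1 : ℝ) * phiTilde + 1) *
    momentCoeff (k + 1) * momentCoeff (r + 1 - k)]

theorem momentCoeff_eq (r : ℕ) (hr : 2 ≤ r) : momentCoeff r =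
    1 / (phiTilde * ((r : ℝ) - 1) * (((r : ℝ) + 1) * phiTilde + 1)) *
      ∑ k ∈ Finset.Icc 1 (r - 1), ((k : ℝ) * phiTilde + 1) * momentCoeff k *
        momentCoeff (r - k) := by
  obtain ⟨r, rfl⟩ : ∃ s, r = s + 2 := ⟨r - 2, by omega⟩
  rw [momentCoeff_add_two, show r + 2 - 1 = r + 1 by omega,
    show Finset.Icc 1 (r + 1) = Finset.Ico 1 (r + 2) by
      ext; simp only [Finset.mem_Icc, Finset.mem_Ico]; omega,
    Finset.sum_Ico_eq_sum_range]
  rw [show r + 2 - 1 = r + 1 by omega]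
  congr 1
  · push_cast
    congr 2 <;> ring
  · refine Finset.sum_congr rfl fun k _ => ?_
    rw [add_comm 1 k, show r + 2 - (k + 1) = r + 1 - k by omega]
    push_cast
    ring

/-- With all earlier coefficients replaced by one, the sum is explicit and does not exceed the
denominator, thanks to `phiTilde ≤ 2 / 3`. The bound serves to control the growth of the moments. -/
theorem momentCoeff_mem (r : ℕ) : 0 ≤ momentCoeff r ∧ momentCoeff r ≤ 1 := by
  have hp := phiTilde_pos
  have hp1 := phiTilde_lt_one
  have hp2 := phiTilde_sq
  induction r using Nat.strong_induction_on with
  | _ r ih =>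
    match r with
    | 0 => simp [momentCoeff]
    | 1 =>
      rw [momentCoeff]
      constructor <;> linarith
    | r + 2 =>
      rw [momentCoeff_add_two]
      set S := ∑ k ∈ Finset.range (r + 1), (((k : ℕ) + 1 : ℝ) * phiTilde + 1) *
        momentCoeff (k + 1) * momentCoeff (r + 1 - k) with hS
      have hS0 : 0 ≤ S := Finset.sum_nonneg fun k hk => by
        have hk := Finset.mem_range.1 hk
        have h1 := (ih (k + 1) (by omega)).1
        have h2 := (ih (r + 1 - k) (by omega)).1
        positivity
      have hS1 : S ≤ ∑ k ∈ Finset.range (r + 1), (((k : ℕ) + 1 : ℝ) * phiTilde + 1) := by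
        refine Finset.sum_le_sum fun k hk => ?_
        have hk := Finset.mem_range.1 hk
        have h1 := ih (k + 1) (by omega)
        have h2 := ih (r + 1 - k) (by omega)
        rw [mul_assoc]
        exact mul_le_of_le_one_right (by positivity) (mul_le_one₀ h1.2 h2.1 h2.2)
      have hS2 : ∀ m : ℕ, ∑ k ∈ Finset.range m, (((k : ℕ) + 1 : ℝ) * phiTilde + 1) =
          m * ((m + 1) / 2 * phiTilde + 1) := by
        intro m
        induction m with
        | zero => simp
        | succ m ih => rw [Finset.sum_range_succ, ih]; push_cast; ring
      have hr : (0 : ℝ) ≤ r := Nat.cast_nonneg r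
      refine ⟨by positivity, ?_⟩
      rw [one_div_mul_eq_div, div_le_one (by positivity)]
      refine hS1.trans ?_
      rw [hS2]
      push_cast
      have h3 : (r + 1 + 1 : ℝ) / 2 * phiTilde + 1 ≤ phiTilde * ((r + 3) * phiTilde + 1) := by
        have h4 : phiTilde * ((r + 3 : ℝ) * phiTilde + 1) = (r + 3) * (1 - phiTilde) + phiTilde := by
          rw [← hp2]; ring
        have h5 : phiTilde ≤ 2 / 3 := by nlinarith
        rw [h4]
        nlinarith
      calc ((r : ℝ) + 1) * ((r + 1 + 1) / 2 * phiTilde + 1)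
          ≤ (r + 1) * (phiTilde * ((r + 3) * phiTilde + 1)) := by gcongr
        _ = _ := by ring

/-! ### Asymptotics of the moments -/

/-- The recursion for the coefficients of the moment generating functions. -/
structure MomentRecursion (x y : ℕ → ℕ → ℝ) : Prop where
  x_zero : ∀ k, x 0 k = 1
  y_zero : ∀ k, y 0 k = 1
  x_one : x 1 0 = 1
  y_one : y 1 0 = 1
  x_succ : ∀ r k : ℕ, ((k : ℝ) + 1) * x r (k + 1) = ∑ i ∈ Finset.range (k + 1), y r i
  y_succ : ∀ r k : ℕ, ((k : ℝ) + 1) * y r (k + 1) =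
    ∑ s ∈ Finset.range (r + 1), conv (y s) (x (r - s)) k

namespace MomentRecursion

variable {x y : ℕ → ℕ → ℝ}

theorem conv_one_left (v : ℕ → ℝ) (k : ℕ) :
    conv (fun _ => 1) v k = ∑ i ∈ Finset.range (k + 1), v i := by
  rw [conv_comm]; simp [conv]

/-- The extreme terms `s = 0` and `s = r` are linear in the `r`-th moments because the zeroth ones
are constantly one; what remains involves lower moments only. -/
theorem y_succ_of_pos (h : MomentRecursion x y) {r : ℕ} (hr : 1 ≤ r) (k : ℕ) :
    ((k : ℝ) + 1) * y r (k + 1) = ∑ i ∈ Finset.range (k + 1), (y r i + x r i) +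
      ∑ s ∈ Finset.range (r - 1), conv (y (s + 1)) (x (r - (s + 1))) k := by
  obtain ⟨r, rfl⟩ : ∃ r', r = r' + 1 := ⟨r - 1, by omega⟩
  rw [h.y_succ, Finset.sum_range_succ, Finset.sum_range_succ', Finset.sum_add_distrib]
  have hx : x 0 = fun _ => 1 := funext h.x_zero
  have hy : y 0 = fun _ => 1 := funext h.y_zero
  rw [Nat.sub_self, hx, hy, Nat.sub_zero, conv_comm (y (r + 1)), conv_one_left, conv_one_left]
  simp only [Nat.add_sub_cancel]
  ring

/-- For `r = 1` the recursion is linear and homogeneous. The ansatz `x = ascBinom α`, `y = (α + 1)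
ascBinom α` requires `(α + 1) ^ 2 = (α + 1) + 1`, with roots `phiTilde` and `-phiTilde - 1`; the two
constants come from the initial values. -/
theorem first_moment (h : MomentRecursion x y) (k : ℕ) :
    x 1 k = (3 + phiTilde) / 5 * ascBinom phiTilde k +
      (2 - phiTilde) / 5 * ascBinom (-phiTilde - 1) k ∧
    y 1 k = (1 + phiTilde) * ((3 + phiTilde) / 5) * ascBinom phiTilde k -
      phiTilde * ((2 - phiTilde) / 5) * ascBinom (-phiTilde - 1) k := by
  have hp2 := phiTilde_sq
  induction k using Nat.strong_induction_on with
  | _ k ih =>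
    cases k with
    | zero =>
      rw [h.x_one, h.y_one, ascBinom_zero, ascBinom_zero]
      exact ⟨by ring, by linear_combination (-2 / 5) * hp2⟩
    | succ k =>
      have hk : (k : ℝ) + 1 ≠ 0 := by positivity
      have h1 := succ_mul_ascBinom_eq_sum phiTilde k
      have h2 := succ_mul_ascBinom_eq_sum (-phiTilde - 1) k
      set s1 := ∑ i ∈ Finset.range (k + 1), ascBinom phiTilde i with hs1
      set s2 := ∑ i ∈ Finset.range (k + 1), ascBinom (-phiTilde - 1) i with hs2
      have hx : ∑ i ∈ Finset.range (k + 1), x 1 i = (3 + phiTilde) / 5 * s1 +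
          (2 - phiTilde) / 5 * s2 := by
        rw [hs1, hs2, Finset.mul_sum, Finset.mul_sum, ← Finset.sum_add_distrib]
        exact Finset.sum_congr rfl fun i hi => (ih i (Finset.mem_range.1 hi)).1
      have hy : ∑ i ∈ Finset.range (k + 1), y 1 i = (1 + phiTilde) * ((3 + phiTilde) / 5) * s1 -
          phiTilde * ((2 - phiTilde) / 5) * s2 := by
        rw [hs1, hs2, Finset.mul_sum, Finset.mul_sum, ← Finset.sum_sub_distrib]
        exact Finset.sum_congr rfl fun i hi => (ih i (Finset.mem_range.1 hi)).2
      have h3 := h.x_succ 1 k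
      have h4 := h.y_succ_of_pos le_rfl k
      rw [hy] at h3
      rw [Finset.sum_add_distrib, hx, hy] at h4
      simp only [Nat.sub_self, Finset.range_zero, Finset.sum_empty, add_zero] at h4
      constructor
      · apply mul_left_cancel₀ hk
        linear_combination h3 - (3 + phiTilde) / 5 * h1 - (2 - phiTilde) / 5 * h2
      · apply mul_left_cancel₀ hk
        linear_combination h4 - (1 + phiTilde) * ((3 + phiTilde) / 5) * h1 +
          phiTilde * ((2 - phiTilde) / 5) * h2 -
          ((3 + phiTilde) / 5 * s1 + (2 - phiTilde) / 5 * s2) * hp2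

theorem Gamma_neg_phiTilde_ne_zero : Real.Gamma (-phiTilde - 1 + 1) ≠ 0 := by
  have hp := phiTilde_pos
  have hp1 := phiTilde_lt_one
  refine Real.Gamma_ne_zero fun m hm => ?_
  have h : phiTilde = m := by linarith
  rw [h] at hp hp1
  have h1 : 0 < m := by exact_mod_cast hp
  have h2 : m < 1 := by exact_mod_cast hp1
  omega

theorem asymptotics_one (h : MomentRecursion x y) :
    ((fun k => x 1 k - momentCoeff 1 * ascBinom phiTilde k) =o[atTop] ascBinom phiTilde) ∧
    ((fun k => y 1 k - (phiTilde + 1) * momentCoeff 1 * ascBinom phiTilde k)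
      =o[atTop] ascBinom phiTilde) := by
  have hp := phiTilde_pos
  have ho : ascBinom (-phiTilde - 1) =o[atTop] ascBinom phiTilde :=
    isLittleO_ascBinom Gamma_neg_phiTilde_ne_zero hp.le (by linarith)
  constructor
  · refine (ho.const_mul_left ((2 - phiTilde) / 5)).congr_left fun k => ?_
    rw [(h.first_moment k).1, momentCoeff]
    ring
  · refine (ho.const_mul_left (-(phiTilde * ((2 - phiTilde) / 5)))).congr_left fun k => ?_
    rw [(h.first_moment k).2, momentCoeff]
    ring

/-- The constant `X` makes `X ascBinom α` and `(α + 1) X ascBinom α` solve the recursion with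
forcing `τ ascBinom (α + 1)`. The errors then obey the same recursion with negligible forcing, whose
homogeneous solutions grow more slowly than `ascBinom α` because `phiTilde < α`. -/
theorem asymptotics_step {x y : ℕ → ℝ} {T : ℕ → ℝ} {α X τ : ℝ} (hα : phiTilde < α)
    (hX : ((α + 1) ^ 2 - (α + 1) - 1) * X = τ)
    (hx : ∀ k : ℕ, ((k : ℝ) + 1) * x (k + 1) = ∑ i ∈ Finset.range (k + 1), y i)
    (hy : ∀ k : ℕ, ((k : ℝ) + 1) * y (k + 1) =
      ∑ i ∈ Finset.range (k + 1), (y i + x i) + T k)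
    (hT : (fun k => T k - τ * ascBinom (α + 1) k) =o[atTop] ascBinom (α + 1)) :
    ((fun k => x k - X * ascBinom α k) =o[atTop] ascBinom α) ∧
    ((fun k => y k - (α + 1) * X * ascBinom α k) =o[atTop] ascBinom α) := by
  have hp := phiTilde_pos
  have hp2 := phiTilde_sq
  have hα0 : 0 < α := hp.trans hα
  have hα1 : 0 < α + 1 := by linarith
  set d : ℕ → ℝ := fun k => x k - X * ascBinom α k with hd
  set e : ℕ → ℝ := fun k => y k - (α + 1) * X * ascBinom α k with he
  set η : ℕ → ℝ := fun k => T k - τ * ascBinom (α + 1) k with hη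
  have hg := fun k => ascBinom_pos hα0.le k
  have hG := fun k => ascBinom_pos hα1.le k
  have hdr : ∀ k : ℕ, ((k : ℝ) + 1) * d (k + 1) = ∑ i ∈ Finset.range (k + 1), e i := by
    intro k
    simp only [hd, he, Finset.sum_sub_distrib, ← Finset.mul_sum]
    linear_combination hx k - X * succ_mul_ascBinom_eq_sum α k
  have her : ∀ k : ℕ, ((k : ℝ) + 1) * e (k + 1) =
      ∑ i ∈ Finset.range (k + 1), (e i + d i) + η k := by
    intro k
    have h1 := hy k
    simp only [hd, he, hη, Finset.sum_sub_distrib, Finset.sum_add_distrib, ← Finset.mul_sum]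
      at h1 ⊢
    have h2 := sum_ascBinom α k
    linear_combination h1 - (α + 1) * X * succ_mul_ascBinom_eq_sum α k - ascBinom (α + 1) k * hX
      - ((α + 1) ^ 2 - (α + 1) - 1) * X * h2
  -- The norm is adapted to the map `(d, e) ↦ (e, d + e)`: as `(1 + phiTilde) * phiTilde = 1`, it
  -- expands this norm by at most its Perron eigenvalue `1 + phiTilde`. Division by `ascBinom α`
  -- gives the contraction factor `(1 + phiTilde) / (α + 1) < 1`.
  set m : ℕ → ℝ := fun k => max |d k| (phiTilde * |e k|) / ascBinom α k with hm
  have hdm : ∀ k, |d k| ≤ m k * ascBinom α k := fun k => by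
    rw [hm]; simp only; rw [div_mul_cancel₀ _ (hg k).ne']; exact le_max_left _ _
  have hem : ∀ k, |e k| ≤ (1 + phiTilde) * (m k * ascBinom α k) := fun k => by
    have h1 : phiTilde * |e k| ≤ m k * ascBinom α k := by
      rw [hm]; simp only; rw [div_mul_cancel₀ _ (hg k).ne']; exact le_max_right _ _
    have h2 : (1 + phiTilde) * phiTilde = 1 := by linear_combination hp2
    calc |e k| = (1 + phiTilde) * (phiTilde * |e k|) := by rw [← mul_assoc, h2, one_mul]
      _ ≤ _ := by gcongr
  have hmain : Tendsto m atTop (𝓝 0) := by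
    refine tendsto_zero_of_le_weighted_mean (w := ascBinom α) (G := ascBinom (α + 1))
      (ε := fun k => phiTilde / (α + 1) * |η k / ascBinom (α + 1) k|)
      (q := (1 + phiTilde) / (α + 1)) (by positivity) ((div_lt_one hα1).2 (by linarith))
      (fun k => by have := hg k; positivity) hg (fun k => (sum_ascBinom α k).symm) ?_ ?_ ?_
    · have h1 : Tendsto (fun k : ℕ => (k : ℝ) + 1) atTop atTop :=
        tendsto_natCast_atTop_atTop.atTop_add tendsto_const_nhds
      refine tendsto_atTop_mono (fun k => ?_) h1
      rw [← sum_ascBinom]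
      have : ∑ i ∈ Finset.range (k + 1), (1 : ℝ) = (k : ℝ) + 1 := by simp
      rw [← this]
      exact Finset.sum_le_sum fun i _ => by
        simpa using monotone_ascBinom hα0.le (Nat.zero_le i)
    · have := (hT.tendsto_div_nhds_zero.abs).const_mul (phiTilde / (α + 1))
      simpa using this
    · intro k
      set S := ∑ i ∈ Finset.range (k + 1), m i * ascBinom α i with hS
      have hk : (0 : ℝ) < (k : ℝ) + 1 := by positivity
      have hGk := hG k
      have hgk := hg (k + 1)
      have hgG := succ_mul_ascBinom_succ' α k
      have hE : ∑ i ∈ Finset.range (k + 1), |e i| ≤ (1 + phiTilde) * S := by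
        rw [hS, Finset.mul_sum]
        exact Finset.sum_le_sum fun i _ => hem i
      have hD : ∑ i ∈ Finset.range (k + 1), |d i| ≤ S := Finset.sum_le_sum fun i _ => hdm i
      have h1 : ((k : ℝ) + 1) * |d (k + 1)| ≤ (1 + phiTilde) * S := by
        rw [show ((k : ℝ) + 1) * |d (k + 1)| = |((k : ℝ) + 1) * d (k + 1)| by
          rw [abs_mul, abs_of_pos hk], hdr]
        exact (Finset.abs_sum_le_sum_abs _ _).trans hE
      have h2 : ((k : ℝ) + 1) * (phiTilde * |e (k + 1)|) ≤ (1 + phiTilde) * S +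
          phiTilde * |η k| := by
        have h3 : ((k : ℝ) + 1) * |e (k + 1)| ≤ (1 + phiTilde) * S + S + |η k| := by
          rw [show ((k : ℝ) + 1) * |e (k + 1)| = |((k : ℝ) + 1) * e (k + 1)| by
          rw [abs_mul, abs_of_pos hk], her]
          refine (abs_add_le _ _).trans (add_le_add_left ?_ _)
          refine (Finset.abs_sum_le_sum_abs _ _).trans ?_
          calc _ ≤ ∑ i ∈ Finset.range (k + 1), (|e i| + |d i|) :=
                Finset.sum_le_sum fun i _ => abs_add_le _ _
            _ ≤ _ := by rw [Finset.sum_add_distrib]; exact add_le_add hE hD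
        calc _ = phiTilde * (((k : ℝ) + 1) * |e (k + 1)|) := by ring
          _ ≤ phiTilde * ((1 + phiTilde) * S + S + |η k|) := by gcongr
          _ = _ := by linear_combination S * hp2
      have h3 : ((k : ℝ) + 1) * max |d (k + 1)| (phiTilde * |e (k + 1)|) ≤
          (1 + phiTilde) * S + phiTilde * |η k| := by
        rcases max_cases |d (k + 1)| (phiTilde * |e (k + 1)|) with ⟨h, _⟩ | ⟨h, _⟩ <;> rw [h]
        · have : 0 ≤ phiTilde * |η k| := by positivity
          linarith
        · exact h2
      calc m (k + 1) = ((k : ℝ) + 1) * max |d (k + 1)| (phiTilde * |e (k + 1)|) /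
            ((α + 1) * ascBinom (α + 1) k) := by
            rw [← hgG, mul_div_mul_left _ _ hk.ne']
        _ ≤ ((1 + phiTilde) * S + phiTilde * |η k|) / ((α + 1) * ascBinom (α + 1) k) := by gcongr
        _ = _ := by
            rw [abs_div, abs_of_pos hGk]
            field_simp
  have key : ∀ (f : ℕ → ℝ) (c : ℝ), (∀ k, |f k| ≤ c * (m k * ascBinom α k)) →
      f =o[atTop] ascBinom α := by
    intro f c hf
    have h1 : (fun k => m k * ascBinom α k) =o[atTop] ascBinom α := by
      have := ((isLittleO_one_iff ℝ).2 hmain).mul_isBigO (isBigO_refl (ascBinom α) atTop)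
      simpa using this
    refine (IsBigO.of_bound c (.of_forall fun k => ?_)).trans_isLittleO h1
    have h2 : 0 ≤ m k * ascBinom α k := (abs_nonneg _).trans (hdm k)
    rw [Real.norm_eq_abs, Real.norm_eq_abs, abs_of_nonneg h2]
    exact hf k
  exact ⟨key d 1 fun k => by rw [one_mul]; exact hdm k, key e _ hem⟩

theorem asymptotics (h : MomentRecursion x y) {r : ℕ} (hr : 1 ≤ r) :
    ((fun k => x r k - momentCoeff r * ascBinom (r * phiTilde) k)
      =o[atTop] ascBinom (r * phiTilde)) ∧
    ((fun k => y r k - (r * phiTilde + 1) * momentCoeff r * ascBinom (r * phiTilde) k)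
      =o[atTop] ascBinom (r * phiTilde)) := by
  have hp := phiTilde_pos
  have hp2 := phiTilde_sq
  induction r using Nat.strong_induction_on with
  | _ r ih =>
    rcases Nat.lt_or_ge r 2 with h2 | h2
    · obtain rfl : r = 1 := by omega
      simpa using h.asymptotics_one
    · obtain ⟨r, rfl⟩ : ∃ s, r = s + 2 := ⟨r - 2, by omega⟩
      have hr0 : (0 : ℝ) ≤ r := Nat.cast_nonneg r
      refine asymptotics_step (τ := ∑ s ∈ Finset.range (r + 1),
          (((s : ℕ) + 1 : ℝ) * phiTilde + 1) * momentCoeff (s + 1) * momentCoeff (r + 1 - s))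
        (T := fun k => ∑ s ∈ Finset.range (r + 1), conv (y (s + 1)) (x (r + 2 - (s + 1))) k)
        ?_ ?_ (h.x_succ _) (h.y_succ_of_pos hr) ?_
      · push_cast; nlinarith
      · have hc := momentCoeff_add_two r
        set S := ∑ s ∈ Finset.range (r + 1), (((s : ℕ) + 1 : ℝ) * phiTilde + 1) *
          momentCoeff (s + 1) * momentCoeff (r + 1 - s)
        have hpos : phiTilde * ((r : ℝ) + 1) * (((r : ℝ) + 3) * phiTilde + 1) ≠ 0 := by positivity
        rw [one_div_mul_eq_div, eq_div_iff hpos] at hc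
        rw [← hc]
        push_cast
        -- At `α = r' * phiTilde` with `r' = r + 2`, the relation `phiTilde ^ 2 + phiTilde = 1`
        -- factors `(α + 1) ^ 2 - (α + 1) - 1` as `phiTilde * (r' - 1) * ((r' + 1) * phiTilde + 1)`.
        linear_combination momentCoeff (r + 2) * hp2
      · have hs : ∀ s ∈ Finset.range (r + 1), (fun k => conv (y (s + 1)) (x (r + 2 - (s + 1))) k -
            (((s : ℕ) + 1 : ℝ) * phiTilde + 1) * momentCoeff (s + 1) * momentCoeff (r + 1 - s) *
            ascBinom (((r + 2 : ℕ) : ℝ) * phiTilde + 1) k)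
            =o[atTop] ascBinom (((r + 2 : ℕ) : ℝ) * phiTilde + 1) := by
          intro s hs
          have hs := Finset.mem_range.1 hs
          have h1 := (ih (s + 1) (by omega) (by omega)).2
          have h2 := (ih (r + 1 - s) (by omega) (by omega)).1
          have h3 := isLittleO_conv_sub (by positivity) (by positivity) h1 h2
          have h4 : ((s + 1 : ℕ) : ℝ) * phiTilde + ((r + 1 - s : ℕ) : ℝ) * phiTilde + 1 =
              ((r + 2 : ℕ) : ℝ) * phiTilde + 1 := by
            rw [Nat.cast_sub (by omega)]; push_cast; ring
          rw [h4] at h3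
          have h5 : r + 2 - (s + 1) = r + 1 - s := by omega
          simpa [h5] using h3
        refine (IsLittleO.sum hs).congr_left fun k => ?_
        rw [Finset.sum_apply, Finset.sum_sub_distrib, Finset.sum_mul]

/-- Index `k` belongs to the network with `k + 1` edges, hence the normalization by `k + 1`;
replacing it by `k` costs a factor tending to one. -/
theorem tendsto_moment (h : MomentRecursion x y) (r : ℕ) :
    Tendsto (fun k : ℕ => x r k / (((k + 1 : ℕ) : ℝ) ^ phiTilde) ^ r) atTop
      (𝓝 (momentCoeff r / Real.Gamma (r * phiTilde + 1))) := by
  have hp := phiTilde_pos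
  rcases Nat.eq_zero_or_pos r with rfl | hr
  · simp [h.x_zero, momentCoeff]
  set α := (r : ℝ) * phiTilde with hα
  have hα0 : 0 ≤ α := by positivity
  have h1 := (h.asymptotics hr).1.tendsto_div_nhds_zero
  have h2 : Tendsto (fun k => x r k / ascBinom α k) atTop (𝓝 (momentCoeff r)) := by
    have := h1.add_const (momentCoeff r)
    rw [zero_add] at this
    refine this.congr fun k => ?_
    have := (ascBinom_pos hα0 k).ne'
    rw [← hα]
    field_simp
    ring
  have h3 := tendsto_ascBinom_div_rpow (Gamma_add_one_ne_zero hα0)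
  have h4 : Tendsto (fun k : ℕ => ((k : ℝ) / (k + 1)) ^ α) atTop (𝓝 1) := by
    have := (tendsto_natCast_div_add_atTop (1 : ℝ)).rpow_const (p := α) (Or.inl one_ne_zero)
    simpa using this
  have h5 := (h2.mul h3).mul h4
  rw [mul_one, ← div_eq_mul_inv] at h5
  refine h5.congr' ?_
  filter_upwards [eventually_gt_atTop 0] with k hk
  have hk : (0 : ℝ) < k := by exact_mod_cast hk
  have hg := (ascBinom_pos hα0 k).ne'
  rw [← Real.rpow_natCast, ← Real.rpow_mul (by positivity), mul_comm phiTilde, ← hα,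
    Real.div_rpow hk.le (by positivity)]
  have : (k : ℝ) ^ α ≠ 0 := by positivity
  push_cast
  field_simp

end MomentRecursion

open PowerSeries in
theorem momentRecursion_growth : MomentRecursion
    (fun r k => coeff r (Network.growth (PowerSeries.exp ℝ) k).1)
    (fun r k => coeff r (Network.growth (PowerSeries.exp ℝ) k).2) := by
  have hx : ∀ r k : ℕ, ((k : ℝ) + 1) * coeff r (Network.growth (PowerSeries.exp ℝ) (k + 1)).1 =
      ∑ i ∈ Finset.range (k + 1), coeff r (Network.growth (PowerSeries.exp ℝ) i).2 := by
    intro r k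
    rw [← smul_eq_mul, ← PowerSeries.coeff_smul, Network.growth_succ_fst, map_sum]
  have hy : ∀ r k : ℕ, ((k : ℝ) + 1) * coeff r (Network.growth (PowerSeries.exp ℝ) (k + 1)).2 =
      ∑ s ∈ Finset.range (r + 1),
        conv (fun i => coeff s (Network.growth (PowerSeries.exp ℝ) i).2)
        (fun i => coeff (r - s) (Network.growth (PowerSeries.exp ℝ) i).1) k := by
    intro r k
    rw [← smul_eq_mul, ← PowerSeries.coeff_smul, Network.growth_succ_snd, map_sum]
    simp only [conv]
    rw [Finset.sum_comm]
    refine Finset.sum_congr rfl fun i _ => ?_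
    rw [coeff_mul, Finset.Nat.sum_antidiagonal_eq_sum_range_succ_mk]
  have h0 : ∀ k, coeff 0 (Network.growth (PowerSeries.exp ℝ) k).1 = 1 ∧
      coeff 0 (Network.growth (PowerSeries.exp ℝ) k).2 = 1 := by
    intro k
    induction k using Nat.strong_induction_on with
    | _ k ih =>
      cases k with
      | zero => simp [Network.growth_zero]
      | succ k =>
        have hk : (k : ℝ) + 1 ≠ 0 := by positivity
        constructor
        · apply mul_left_cancel₀ hk
          rw [hx, Finset.sum_congr rfl fun i hi => (ih i (Finset.mem_range.1 hi)).2]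
          simp
        · apply mul_left_cancel₀ hk
          rw [hy]
          simp only [zero_add, Finset.sum_range_one, conv]
          rw [Finset.sum_congr rfl fun i hi => by
            rw [(ih i (Finset.mem_range.1 hi)).2, (ih (k - i) (by omega)).1]]
          simp
  exact ⟨fun k => (h0 k).1, fun k => (h0 k).2, by simp [Network.growth_zero, coeff_exp],
    by simp [Network.growth_zero, coeff_exp], hx, hy⟩

/-! ### The method of moments -/

section MethodOfMoments

open Real

/-- The exponential is dominated by `2 cosh`, whose series involves only even powers, so it can be
integrated termwise without absolute moments. The terms are bounded by `C * (1 / 4) ^ k`. -/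
theorem integrable_exp_mul_of_moment_bound {ν : Measure ℝ} {m : ℕ → ℝ} (hν : HasMoments ν m)
    {C : ℝ} (hC : ∀ k, m k ≤ C * k.factorial) {t : ℝ} (ht : |t| ≤ 1 / 2) :
    Integrable (fun x : ℝ => rexp (t * x)) ν := by
  have hC0 : 0 ≤ C := by
    have h0 := (hν 0).2
    have h1 := hC 0
    have h2 : 0 ≤ ∫ x, x ^ 0 ∂ν := integral_nonneg fun x => by simp
    rw [h0] at h2
    simpa using h2.trans h1
  have hcosh : Integrable (fun x : ℝ => cosh (t * x)) ν := by
    refine ⟨by fun_prop, ?_⟩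
    rw [hasFiniteIntegral_iff_ofReal (ae_of_all _ fun x => (cosh_pos _).le)]
    have hs : ∀ x : ℝ, ENNReal.ofReal (cosh (t * x)) =
        ∑' k : ℕ, ENNReal.ofReal ((t * x) ^ (2 * k) / (2 * k).factorial) := by
      intro x
      rw [← (hasSum_cosh (t * x)).tsum_eq, ENNReal.ofReal_tsum_of_nonneg]
      · intro k
        have : 0 ≤ (t * x) ^ (2 * k) := (even_two_mul k).pow_nonneg _
        positivity
      · exact (hasSum_cosh (t * x)).summable
    simp only [hs]
    rw [lintegral_tsum fun k => by fun_prop]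
    have hb : ∀ k : ℕ, ∫⁻ x, ENNReal.ofReal ((t * x) ^ (2 * k) / (2 * k).factorial) ∂ν ≤
        ENNReal.ofReal (C * (1 / 4) ^ k) := by
      intro k
      have hi : Integrable (fun x : ℝ => (t * x) ^ (2 * k) / (2 * k).factorial) ν := by
        simp only [mul_pow]
        exact ((hν (2 * k)).1.const_mul _).div_const _
      rw [← ofReal_integral_eq_lintegral_ofReal hi (ae_of_all _ fun x => by
        have : 0 ≤ (t * x) ^ (2 * k) := (even_two_mul k).pow_nonneg _
        simp only [Pi.zero_apply]
        positivity)]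
      refine ENNReal.ofReal_le_ofReal ?_
      simp only [mul_pow]
      rw [integral_div, integral_const_mul, (hν (2 * k)).2]
      have h1 : t ^ (2 * k) ≤ (1 / 4) ^ k := by
        rw [pow_mul]
        refine pow_le_pow_left₀ (sq_nonneg t) ?_ k
        rw [← sq_abs]
        nlinarith [abs_nonneg t]
      have h2 : 0 ≤ t ^ (2 * k) := (even_two_mul k).pow_nonneg _
      have hf : (0 : ℝ) < (2 * k).factorial := by positivity
      rw [div_le_iff₀ hf]
      calc t ^ (2 * k) * m (2 * k) ≤ t ^ (2 * k) * (C * (2 * k).factorial) := by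
            gcongr; exact hC _
        _ ≤ (1 / 4) ^ k * (C * (2 * k).factorial) := by gcongr
        _ = _ := by ring
    refine (ENNReal.tsum_le_tsum hb).trans_lt ?_
    rw [← ENNReal.ofReal_tsum_of_nonneg (fun k => by positivity)
      ((summable_geometric_of_lt_one (by norm_num) (by norm_num)).mul_left C)]
    exact ENNReal.ofReal_lt_top
  refine (hcosh.const_mul 2).mono (by fun_prop) (ae_of_all _ fun x => ?_)
  rw [norm_of_nonneg (exp_pos _).le, norm_of_nonneg (by have := cosh_pos (t * x); positivity),
    cosh_eq]
  have := exp_pos (-(t * x))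
  linarith

/-- Moments that grow at most like factorials determine a probability measure. -/
theorem HasMoments.unique {ν ν' : Measure ℝ} [IsProbabilityMeasure ν] [IsProbabilityMeasure ν']
    {m : ℕ → ℝ} (hν : HasMoments ν m) (hν' : HasMoments ν' m) {C : ℝ}
    (hC : ∀ k, m k ≤ C * k.factorial) : ν = ν' := by
  have hint : ∀ {ρ : Measure ℝ}, HasMoments ρ m →
      Set.Ioo (-(1 / 2) : ℝ) (1 / 2) ⊆ interior (integrableExpSet id ρ) := by
    intro ρ hρ
    refine interior_maximal (fun t ht => ?_) isOpen_Ioo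
    exact integrable_exp_mul_of_moment_bound hρ hC (abs_le.2 ⟨ht.1.le, ht.2.le⟩)
  -- Both complex moment generating functions are analytic on this strip and share all derivatives
  -- at zero. The identity theorem carries equality to the imaginary axis, where they are the
  -- characteristic functions.
  set U : Set ℂ := {z | z.re ∈ Set.Ioo (-(1 / 2) : ℝ) (1 / 2)} with hU
  have hconv : IsPreconnected U :=
    ((convex_Ioo (-(1 / 2) : ℝ) (1 / 2)).linear_preimage Complex.reLm).isPreconnected
  have han : ∀ {ρ : Measure ℝ}, HasMoments ρ m → AnalyticOnNhd ℂ (complexMGF id ρ) U :=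
    fun hρ z hz => analyticAt_complexMGF (hint hρ hz)
  have h0U : (0 : ℂ) ∈ U := by simp [hU]
  have hder : ∀ {ρ : Measure ℝ}, HasMoments ρ m → ∀ n,
      iteratedDeriv n (complexMGF id ρ) 0 = m n := by
    intro ρ hρ n
    rw [iteratedDeriv_complexMGF (hint hρ h0U)]
    simp only [id, zero_mul, Complex.exp_zero, mul_one]
    rw [← (hρ n).2, ← integral_complex_ofReal]
    simp
  have hev : complexMGF id ν =ᶠ[𝓝 0] complexMGF id ν' := by
    have h1 := (han hν 0 h0U).hasFPowerSeriesAt.eventually_hasSum_sub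
    have h2 := (han hν' 0 h0U).hasFPowerSeriesAt.eventually_hasSum_sub
    simp only [hder hν] at h1
    simp only [hder hν'] at h2
    filter_upwards [h1, h2] with z hz1 hz2 using hz1.unique hz2
  have heq := (han hν).eqOn_of_preconnected_of_eventuallyEq (han hν') hconv h0U hev
  refine Measure.ext_of_charFun (funext fun t => ?_)
  rw [← complexMGF_id_mul_I, ← complexMGF_id_mul_I]
  exact heq (by simp [hU])

/-- The exponent on the right is even and at least `r + 1`, so outside `[-K, K]` it leaves a factor
`K` to spare. This makes the truncation error uniform along a sequence with bounded moments. -/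
theorem abs_pow_sub_clip_pow_le {K : ℝ} (hK : 1 ≤ K) (x : ℝ) (r : ℕ) :
    |x ^ r - (max (-K) (min x K)) ^ r| ≤ 2 / K * x ^ (2 * (r + 1)) := by
  have hK0 : 0 < K := by linarith
  have hx2 : 0 ≤ x ^ (2 * (r + 1)) := (even_two_mul _).pow_nonneg _
  rcases le_or_gt |x| K with h | h
  · obtain ⟨h1, h2⟩ := abs_le.1 h
    rw [min_eq_left h2, max_eq_right h1, sub_self, abs_zero]
    positivity
  · have hc : |max (-K) (min x K)| ≤ |x| := by
      refine le_trans (abs_le.2 ⟨le_max_left _ _, ?_⟩) h.le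
      exact max_le (by linarith) (min_le_right _ _)
    have h1 : |x ^ r - (max (-K) (min x K)) ^ r| ≤ 2 * |x| ^ r := by
      refine (abs_sub _ _).trans ?_
      rw [abs_pow, abs_pow]
      have := pow_le_pow_left₀ (abs_nonneg _) hc r
      linarith
    refine h1.trans ?_
    have hx1 : 1 ≤ |x| := hK.trans h.le
    have h2 : K * |x| ^ r ≤ x ^ (2 * (r + 1)) := by
      calc K * |x| ^ r ≤ |x| * |x| ^ r := by gcongr
        _ = |x| ^ (r + 1) := by ring
        _ ≤ |x| ^ (2 * (r + 1)) := pow_le_pow_right₀ hx1 (by omega)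
        _ = x ^ (2 * (r + 1)) := (even_two_mul _).pow_abs x
    rw [div_mul_eq_mul_div, le_div_iff₀ hK0]
    linarith

theorem hasMoments_of_tendsto {ι : Type*} {l : Filter ι} [NeBot l] {μ : ι → ProbabilityMeasure ℝ}
    {ν : ProbabilityMeasure ℝ} {m : ℕ → ℝ} (hμ : Tendsto μ l (𝓝 ν))
    (hi : ∀ i r, Integrable (fun x : ℝ => x ^ r) (μ i : Measure ℝ))
    (hm : ∀ r, Tendsto (fun i => ∫ x, x ^ r ∂(μ i : Measure ℝ)) l (𝓝 (m r))) :
    HasMoments (ν : Measure ℝ) m := by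
  rw [ProbabilityMeasure.tendsto_iff_forall_integral_tendsto] at hμ
  have heven : ∀ r, Integrable (fun x : ℝ => x ^ (2 * r)) (ν : Measure ℝ) ∧
      ∫ x, x ^ (2 * r) ∂(ν : Measure ℝ) ≤ m (2 * r) := by
    intro r
    have hnn : ∀ x : ℝ, 0 ≤ x ^ (2 * r) := fun x => (even_two_mul r).pow_nonneg x
    have hm0 : 0 ≤ m (2 * r) := ge_of_tendsto' (hm (2 * r)) fun i => integral_nonneg hnn
    -- Weak convergence applies only to bounded functions, so the even power is capped; Fatou's
    -- lemma then removes the cap.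
    have hK : ∀ K : ℕ, ∫⁻ x, ENNReal.ofReal (min (x ^ (2 * r)) K) ∂(ν : Measure ℝ) ≤
        ENNReal.ofReal (m (2 * r)) := by
      intro K
      have hKnn : ∀ x : ℝ, 0 ≤ min (x ^ (2 * r)) (K : ℝ) := fun x =>
        le_min (hnn x) (Nat.cast_nonneg K)
      let f : BoundedContinuousFunction ℝ ℝ := BoundedContinuousFunction.ofNormedAddCommGroup
        (fun x : ℝ => min (x ^ (2 * r)) K) (by fun_prop) K (fun x => by
          rw [norm_of_nonneg (hKnn x)]; exact min_le_right _ _)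
      have hf : Integrable (fun x : ℝ => min (x ^ (2 * r)) (K : ℝ)) (ν : Measure ℝ) :=
        f.integrable (ν : Measure ℝ)
      rw [← ofReal_integral_eq_lintegral_ofReal hf (ae_of_all _ hKnn)]
      refine ENNReal.ofReal_le_ofReal (le_of_tendsto_of_tendsto' (hμ f) (hm (2 * r)) fun i => ?_)
      exact integral_mono (f.integrable _) (hi i _) fun x => min_le_left _ _
    have hlim : ∫⁻ x, ENNReal.ofReal (x ^ (2 * r)) ∂(ν : Measure ℝ) ≤
        ENNReal.ofReal (m (2 * r)) := by
      have h1 : ∀ x : ℝ, ENNReal.ofReal (x ^ (2 * r)) =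
          liminf (fun K : ℕ => ENNReal.ofReal (min (x ^ (2 * r)) K)) atTop := by
        intro x
        refine (Tendsto.liminf_eq (tendsto_const_nhds.congr' ?_)).symm
        obtain ⟨N, hN⟩ := exists_nat_gt (x ^ (2 * r))
        filter_upwards [eventually_ge_atTop N] with K hK
        rw [min_eq_left]
        exact hN.le.trans (by exact_mod_cast hK)
      simp only [h1]
      refine (lintegral_liminf_le fun K => by fun_prop).trans ?_
      exact liminf_le_of_frequently_le' (Frequently.of_forall hK)
    have hint : Integrable (fun x : ℝ => x ^ (2 * r)) (ν : Measure ℝ) := by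
      refine ⟨by fun_prop, ?_⟩
      rw [hasFiniteIntegral_iff_ofReal (ae_of_all _ hnn)]
      exact hlim.trans_lt ENNReal.ofReal_lt_top
    refine ⟨hint, ?_⟩
    rw [← ofReal_integral_eq_lintegral_ofReal hint (ae_of_all _ hnn)] at hlim
    exact (ENNReal.ofReal_le_ofReal_iff hm0).1 hlim
  intro r
  have hint : Integrable (fun x : ℝ => x ^ r) (ν : Measure ℝ) := by
    refine ((integrable_const (1 : ℝ)).add (heven r).1).mono (by fun_prop) (ae_of_all _ fun x => ?_)
    have hnn : 0 ≤ x ^ (2 * r) := (even_two_mul r).pow_nonneg x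
    simp only [Pi.add_apply]
    rw [norm_of_nonneg (by positivity : 0 ≤ 1 + x ^ (2 * r)), norm_eq_abs, pow_mul', ← sq_abs]
    nlinarith [sq_nonneg (|x ^ r| - 1), sq_nonneg (|x ^ r|)]
  refine ⟨hint, ?_⟩
  have hclip : ∀ K : ℝ, 1 ≤ K → |∫ x, x ^ r ∂(ν : Measure ℝ) - m r| ≤
      4 * m (2 * (r + 1)) * K⁻¹ := by
    intro K hK
    have hK0 : 0 < K := by linarith
    let f : BoundedContinuousFunction ℝ ℝ := BoundedContinuousFunction.ofNormedAddCommGroup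
      (fun x : ℝ => (max (-K) (min x K)) ^ r) (by fun_prop) (K ^ r) (fun x => by
        rw [norm_pow, norm_eq_abs]
        refine pow_le_pow_left₀ (abs_nonneg _) (abs_le.2 ⟨le_max_left _ _, ?_⟩) r
        exact max_le (by linarith) (min_le_right _ _))
    have hb : ∀ ρ : ProbabilityMeasure ℝ, Integrable (fun x : ℝ => x ^ r) (ρ : Measure ℝ) →
        Integrable (fun x : ℝ => x ^ (2 * (r + 1))) (ρ : Measure ℝ) →
        |∫ x, x ^ r ∂(ρ : Measure ℝ) - ∫ x, f x ∂(ρ : Measure ℝ)| ≤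
          2 / K * ∫ x, x ^ (2 * (r + 1)) ∂(ρ : Measure ℝ) := by
      intro ρ h1 h2
      rw [← integral_sub h1 (f.integrable _), ← integral_const_mul]
      refine (abs_integral_le_integral_abs).trans (integral_mono ?_ (h2.const_mul _) fun x => ?_)
      · exact (h1.sub (f.integrable _)).abs
      · exact abs_pow_sub_clip_pow_le hK x r
    have h1 := hb ν hint (heven (r + 1)).1
    have h2 : |m r - ∫ x, f x ∂(ν : Measure ℝ)| ≤ 2 / K * m (2 * (r + 1)) :=
      le_of_tendsto_of_tendsto' (((hm r).sub (hμ f)).abs) ((hm (2 * (r + 1))).const_mul _)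
        fun i => hb (μ i) (hi i _) (hi i _)
    have h3 : 2 / K * ∫ x, x ^ (2 * (r + 1)) ∂(ν : Measure ℝ) ≤ 2 / K * m (2 * (r + 1)) := by
      gcongr; exact (heven (r + 1)).2
    have h4 := abs_sub_le (∫ x, x ^ r ∂(ν : Measure ℝ)) (∫ x, f x ∂(ν : Measure ℝ)) (m r)
    rw [abs_sub_comm (m r)] at h2
    have h5 : 4 * m (2 * (r + 1)) * K⁻¹ = 2 / K * m (2 * (r + 1)) + 2 / K * m (2 * (r + 1)) := by
      ring
    rw [h5]
    linarith
  have hz : |∫ x, x ^ r ∂(ν : Measure ℝ) - m r| ≤ 0 := by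
    have ht : Tendsto (fun K : ℝ => 4 * m (2 * (r + 1)) * K⁻¹) atTop (𝓝 0) := by
      simpa using tendsto_inv_atTop_zero.const_mul (4 * m (2 * (r + 1)))
    refine ge_of_tendsto ht ?_
    filter_upwards [eventually_ge_atTop 1] with K hK using hclip K hK
  exact sub_eq_zero.1 (abs_nonpos_iff.1 hz)

theorem isTightMeasureSet_of_second_moment_le {S : Set (Measure ℝ)} {B : ℝ}
    (hi : ∀ μ ∈ S, Integrable (fun x : ℝ => x ^ 2) μ) (hB : ∀ μ ∈ S, ∫ x, x ^ 2 ∂μ ≤ B) :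
    IsTightMeasureSet S := by
  refine isTightMeasureSet_of_tendsto_measure_norm_gt ?_
  have hlim : Tendsto (fun a : ℝ => ENNReal.ofReal (B / a ^ 2)) atTop (𝓝 0) := by
    have h : Tendsto (fun a : ℝ => B / a ^ 2) atTop (𝓝 0) :=
      (tendsto_pow_atTop two_ne_zero).const_div_atTop B
    simpa using ENNReal.tendsto_ofReal h
  refine tendsto_of_tendsto_of_tendsto_of_le_of_le' tendsto_const_nhds hlim
    (.of_forall fun _ => zero_le) ?_
  filter_upwards [eventually_gt_atTop 0] with a ha
  refine iSup₂_le fun μ hμ => ?_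
  have ha2 : 0 < a ^ 2 := by positivity
  have h1 : {x : ℝ | a < ‖x‖} ⊆ {x : ℝ | ENNReal.ofReal (a ^ 2) ≤ ENNReal.ofReal (x ^ 2)} := by
    intro x hx
    refine ENNReal.ofReal_le_ofReal ?_
    rw [← sq_abs x]
    exact pow_le_pow_left₀ ha.le (le_of_lt hx) 2
  refine (measure_mono h1).trans ?_
  refine (meas_ge_le_lintegral_div (by fun_prop) (by simpa using ha.ne')
    ENNReal.ofReal_ne_top).trans ?_
  rw [← ofReal_integral_eq_lintegral_ofReal (hi μ hμ) (ae_of_all _ fun x => sq_nonneg x),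
    ← ENNReal.ofReal_div_of_pos ha2]
  exact ENNReal.ofReal_le_ofReal (by gcongr; exact hB μ hμ)

/-- The method of moments: if all moments converge and the limits grow at most like factorials,
then the measures converge weakly to the unique measure with these moments. -/
theorem exists_tendsto_of_tendsto_moments {μ : ℕ → ProbabilityMeasure ℝ} {m : ℕ → ℝ} {C : ℝ}
    (hi : ∀ n r, Integrable (fun x : ℝ => x ^ r) (μ n : Measure ℝ))
    (hm : ∀ r, Tendsto (fun n => ∫ x, x ^ r ∂(μ n : Measure ℝ)) atTop (𝓝 (m r)))
    (hC : ∀ k, m k ≤ C * k.factorial) :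
    ∃ ν : ProbabilityMeasure ℝ, HasMoments (ν : Measure ℝ) m ∧ Tendsto μ atTop (𝓝 ν) := by
  obtain ⟨B, hB⟩ := (hm 2).bddAbove_range
  have htight : IsTightMeasureSet {((ρ : ProbabilityMeasure ℝ) : Measure ℝ) | ρ ∈ Set.range μ} := by
    refine isTightMeasureSet_of_second_moment_le (B := B) ?_ ?_
    · rintro _ ⟨_, ⟨n, rfl⟩, rfl⟩
      exact hi n 2
    · rintro _ ⟨_, ⟨n, rfl⟩, rfl⟩
      exact hB ⟨n, rfl⟩
  have hcomp := isCompact_closure_of_isTightMeasureSet htight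
  have hmem : ∀ n, μ n ∈ closure (Set.range μ) := fun n => subset_closure ⟨n, rfl⟩
  -- Every cluster point is a limit along an ultrafilter and so has the moments `m`; by uniqueness
  -- all cluster points coincide, which in a compact set forces convergence.
  have hcl : ∀ ν, MapClusterPt ν atTop μ → HasMoments (ν : Measure ℝ) m := by
    intro ν hν
    obtain ⟨U, hU, hUν⟩ := mapClusterPt_iff_ultrafilter.1 hν
    exact hasMoments_of_tendsto hUν hi fun r => (hm r).mono_left hU
  obtain ⟨ν, -, hν⟩ := hcomp.exists_mapClusterPt (f := atTop) (u := μ)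
    (le_principal_iff.2 (mem_map.2 (univ_mem' hmem)))
  refine ⟨ν, hcl ν hν, hcomp.tendsto_nhds_of_unique_mapClusterPt (.of_forall hmem) ?_⟩
  intro ρ _ hρ
  have := ν.2
  have := ρ.2
  exact Subtype.ext ((hcl ρ hρ).unique (hcl ν hν) hC)

end MethodOfMoments

/-! ### The mean path length and the limit law -/

theorem eval_ascPochhammer_succ (α : ℝ) (k : ℕ) :
    (ascPochhammer ℝ (k + 1)).eval α = α * (k.factorial * ascBinom α k) := by
  induction k with
  | zero => simp
  | succ k ih =>
    rw [ascPochhammer_succ_eval, ih, Nat.factorial_succ]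
    push_cast
    linear_combination -(α * k.factorial) * succ_mul_ascBinom_succ α k

/-- The binomial coefficients of the closed form have as many factors as the network has edges, one
more than `ascBinom α k`; the extra factor is `α`. -/
theorem succ_mul_choose (α : ℝ) (k : ℕ) :
    ((k : ℝ) + 1) * Ring.choose (α + ((k + 1 : ℕ) : ℝ) - 1) (k + 1) = α * ascBinom α k := by
  rw [← Ring.multichoose_eq]
  have h := Ring.factorial_nsmul_multichoose_eq_ascPochhammer α (k + 1)
  rw [Polynomial.ascPochhammer_smeval_eq_eval, eval_ascPochhammer_succ, nsmul_eq_mul,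
    Nat.factorial_succ] at h
  have hk : (k.factorial : ℝ) ≠ 0 := by positivity
  apply mul_left_cancel₀ hk
  push_cast at h
  linear_combination h

open PowerSeries in
theorem expectation_pathLengthLaw (k : ℕ) :
    ∫ l : ℕ, (l : ℝ) ∂(pathLengthLaw (k + 1)).toMeasure =
      coeff 1 (Network.growth (PowerSeries.exp ℝ) k).1 := by
  simpa using (integral_pathLengthLaw k 1).2

theorem expectation_pathLengthLaw_eq (n : ℕ) (hn : 1 ≤ n) :
    ∫ l : ℕ, (l : ℝ) ∂(pathLengthLaw n).toMeasure =
      (n : ℝ) * ((3 + √5) / (2 * √5) * Ring.choose ((n : ℝ) + √5 / 2 - 3 / 2) n -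
        (3 - √5) / (2 * √5) * Ring.choose ((n : ℝ) - √5 / 2 - 3 / 2) n) := by
  obtain ⟨k, rfl⟩ : ∃ k, n = k + 1 := ⟨n - 1, by omega⟩
  rw [expectation_pathLengthLaw, (momentRecursion_growth.first_moment k).1]
  have h1 := succ_mul_choose phiTilde k
  have h2 := succ_mul_choose (-phiTilde - 1) k
  have e1 : phiTilde + ((k + 1 : ℕ) : ℝ) - 1 = ((k + 1 : ℕ) : ℝ) + √5 / 2 - 3 / 2 := by
    rw [phiTilde]; ring
  have e2 : -phiTilde - 1 + ((k + 1 : ℕ) : ℝ) - 1 = ((k + 1 : ℕ) : ℝ) - √5 / 2 - 3 / 2 := by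
    rw [phiTilde]; ring
  rw [e1] at h1
  rw [e2] at h2
  have h5 : √5 ^ 2 = (5 : ℝ) := Real.sq_sqrt (by norm_num)
  have h50 : (√5 : ℝ) ≠ 0 := by positivity
  have c1 : (3 + phiTilde) / 5 = (3 + √5) / (2 * √5) * phiTilde := by
    rw [phiTilde]; field_simp; linear_combination -3 * h5
  have c2 : (2 - phiTilde) / 5 = -((3 - √5) / (2 * √5)) * (-phiTilde - 1) := by
    rw [phiTilde]; field_simp; linear_combination 3 * h5
  rw [c1, c2]
  push_cast at h1 h2 ⊢
  linear_combination -((3 + √5) / (2 * √5)) * h1 + ((3 - √5) / (2 * √5)) * h2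

theorem tendsto_expectation_div :
    Tendsto (fun n : ℕ => (∫ l : ℕ, (l : ℝ) ∂(pathLengthLaw n).toMeasure) / (n : ℝ) ^ phiTilde)
      atTop (𝓝 ((1 + √5) / (2 * √5) / Real.Gamma (phiTilde + 1))) := by
  rw [← tendsto_add_atTop_iff_nat 1]
  simp only [expectation_pathLengthLaw]
  have h := momentRecursion_growth.tendsto_moment 1
  have h5 : √5 ^ 2 = (5 : ℝ) := Real.sq_sqrt (by norm_num)
  have h50 : (√5 : ℝ) ≠ 0 := by positivity
  have hc : momentCoeff 1 = (1 + √5) / (2 * √5) := by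
    rw [momentCoeff, phiTilde]; field_simp; linear_combination h5
  rw [hc] at h
  simpa using h

theorem isEquivalent_expectation :
    (fun n : ℕ => ∫ l : ℕ, (l : ℝ) ∂(pathLengthLaw n).toMeasure) ~[atTop]
      (fun n : ℕ => (1 + √5) / (2 * √5) * ((n : ℝ) ^ phiTilde / Real.Gamma (phiTilde + 1))) := by
  have hΓ : 0 < Real.Gamma (phiTilde + 1) :=
    Real.Gamma_pos_of_pos (by have := phiTilde_pos; linarith)
  have hc : 0 < (1 + √5) / (2 * √5) / Real.Gamma (phiTilde + 1) := by positivity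
  have h := tendsto_expectation_div.div_const ((1 + √5) / (2 * √5) / Real.Gamma (phiTilde + 1))
  rw [div_self hc.ne'] at h
  refine (isEquivalent_iff_tendsto_one ?_).2 (h.congr fun n => ?_)
  · filter_upwards [eventually_gt_atTop 0] with n hn
    have : (0 : ℝ) < n := by exact_mod_cast hn
    positivity
  · rw [Pi.div_apply, div_div]
    congr 1
    ring

/-- Only `r = 1` can have an argument of Gamma strictly between one and two, and it accounts for the
term with `Gamma (phiTilde + 1)`. From `r = 2` on, the argument is at least two, where Gamma is
increasing and at least one. -/
theorem moment_le (r : ℕ) :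
    (r.factorial : ℝ) * momentCoeff r / Real.Gamma ((r : ℝ) * phiTilde + 1) ≤
      (1 + (Real.Gamma (phiTilde + 1))⁻¹) * r.factorial := by
  have hp := phiTilde_pos
  have hΓ1 : 0 < Real.Gamma (phiTilde + 1) := Real.Gamma_pos_of_pos (by linarith)
  have hΓ : 0 < Real.Gamma ((r : ℝ) * phiTilde + 1) := Real.Gamma_pos_of_pos (by positivity)
  have key : (Real.Gamma ((r : ℝ) * phiTilde + 1))⁻¹ ≤ 1 + (Real.Gamma (phiTilde + 1))⁻¹ := by
    have h0 : 0 < (Real.Gamma (phiTilde + 1))⁻¹ := inv_pos.2 hΓ1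
    match r with
    | 0 => simp [h0.le]
    | 1 => simp
    | r + 2 =>
      have h2 : (2 : ℝ) ≤ ((r + 2 : ℕ) : ℝ) * phiTilde + 1 := by
        have h3 : (1 : ℝ) / 2 ≤ phiTilde := by
          have := phiTilde_sq
          nlinarith
        have : (2 : ℝ) ≤ ((r + 2 : ℕ) : ℝ) := by push_cast; linarith [Nat.cast_nonneg (α := ℝ) r]
        nlinarith
      have h4 := Real.Gamma_strictMonoOn_Ici.monotoneOn (Set.mem_Ici.2 le_rfl) (Set.mem_Ici.2 h2) h2
      rw [Real.Gamma_two] at h4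
      have := inv_le_one_of_one_le₀ h4
      linarith
  have hc := momentCoeff_mem r
  calc (r.factorial : ℝ) * momentCoeff r / Real.Gamma ((r : ℝ) * phiTilde + 1)
      = momentCoeff r * (Real.Gamma ((r : ℝ) * phiTilde + 1))⁻¹ * r.factorial := by ring
    _ ≤ 1 * (1 + (Real.Gamma (phiTilde + 1))⁻¹) * r.factorial := by
      have := inv_pos.2 hΓ
      gcongr
      exact hc.2
    _ = _ := by ring

theorem exists_limit_law : ∃ ν : ProbabilityMeasure ℝ,
    HasMoments (ν : Measure ℝ)
      (fun r => (r.factorial : ℝ) * momentCoeff r / Real.Gamma ((r : ℝ) * phiTilde + 1)) ∧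
    TendstoInDistribution (fun (n : ℕ) (l : ℕ) => (l : ℝ) / (n : ℝ) ^ phiTilde) atTop
      (fun x : ℝ => x) (fun n => (pathLengthLaw n).toMeasure) (ν : Measure ℝ) := by
  have hmeas : ∀ n : ℕ, AEMeasurable (fun l : ℕ => (l : ℝ) / (n : ℝ) ^ phiTilde)
      (pathLengthLaw n).toMeasure := fun n => measurable_from_nat.aemeasurable
  let μ : ℕ → ProbabilityMeasure ℝ := fun n =>
    ⟨(pathLengthLaw n).toMeasure.map (fun l : ℕ => (l : ℝ) / (n : ℝ) ^ phiTilde),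
      Measure.isProbabilityMeasure_map (hmeas n)⟩
  have hi : ∀ n r, Integrable (fun x : ℝ => x ^ r) (μ (n + 1) : Measure ℝ) := by
    intro n r
    refine (integrable_map_measure (by fun_prop) (hmeas _)).2 ?_
    simp only [Function.comp_def, div_pow]
    exact (integral_pathLengthLaw n r).1.div_const _
  have hint : ∀ n r, ∫ x, x ^ r ∂(μ (n + 1) : Measure ℝ) = r.factorial *
      (PowerSeries.coeff r (Network.growth (PowerSeries.exp ℝ) n).1 /
        (((n + 1 : ℕ) : ℝ) ^ phiTilde) ^ r) := by
    intro n r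
    refine (integral_map (hmeas _) (by fun_prop)).trans ?_
    simp only [div_pow]
    rw [integral_div, (integral_pathLengthLaw n r).2, mul_div_assoc]
  -- The shift discards the conventional law at size zero.
  obtain ⟨ν, hν, ht⟩ := exists_tendsto_of_tendsto_moments (μ := fun n => μ (n + 1)) hi
    (m := fun r => (r.factorial : ℝ) * momentCoeff r / Real.Gamma ((r : ℝ) * phiTilde + 1))
    (fun r => by
      simp only [hint, mul_div_assoc]
      exact (momentRecursion_growth.tendsto_moment r).const_mul _) moment_le
  refine ⟨ν, hν, hmeas, by fun_prop, ?_⟩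
  have hlim : (⟨(ν : Measure ℝ).map (fun x => x), Measure.isProbabilityMeasure_map (by fun_prop)⟩ :
      ProbabilityMeasure ℝ) = ν := Subtype.ext Measure.map_id'
  rw [hlim]
  exact (tendsto_add_atTop_iff_nat 1).1 ht

end

theorem theorem4 :
    (∃ c : ℕ → ℝ,
      c 0 = 1 ∧ c 1 = (3 + phiTilde) / 5 ∧
      (∀ r : ℕ, 2 ≤ r →
        c r = 1 / (phiTilde * ((r : ℝ) - 1) * (((r : ℝ) + 1) * phiTilde + 1)) *
          ∑ k ∈ Finset.Icc 1 (r - 1), ((k : ℝ) * phiTilde + 1) * c k * c (r - k)) ∧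
      ∃ (ν : Measure ℝ) (_ : IsProbabilityMeasure ν),
        HasMoments ν (fun r => (r.factorial : ℝ) * c r / Real.Gamma ((r : ℝ) * phiTilde + 1)) ∧
        (∀ ν' : Measure ℝ, IsProbabilityMeasure ν' →
          HasMoments ν' (fun r => (r.factorial : ℝ) * c r / Real.Gamma ((r : ℝ) * phiTilde + 1)) →
          ν' = ν) ∧
        TendstoInDistribution (fun (n : ℕ) (l : ℕ) => (l : ℝ) / (n : ℝ) ^ phiTilde) atTop
          (fun x : ℝ => x) (fun n => (pathLengthLaw n).toMeasure) ν) ∧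
    (∀ n : ℕ, 1 ≤ n →
      Integrable (fun l : ℕ => (l : ℝ)) (pathLengthLaw n).toMeasure ∧
      ∫ l : ℕ, (l : ℝ) ∂(pathLengthLaw n).toMeasure =
        (n : ℝ) * ((3 + √5) / (2 * √5) * Ring.choose ((n : ℝ) + √5 / 2 - 3 / 2) n -
          (3 - √5) / (2 * √5) * Ring.choose ((n : ℝ) - √5 / 2 - 3 / 2) n)) ∧
    (fun n : ℕ => ∫ l : ℕ, (l : ℝ) ∂(pathLengthLaw n).toMeasure) ~[atTop]
      (fun n : ℕ => (1 + √5) / (2 * √5) * ((n : ℝ) ^ phiTilde / Real.Gamma (phiTilde + 1))) := by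
  refine ⟨⟨momentCoeff, by rw [momentCoeff], by rw [momentCoeff], momentCoeff_eq, ?_⟩,
    fun n hn => ⟨?_, expectation_pathLengthLaw_eq n hn⟩, isEquivalent_expectation⟩
  · obtain ⟨ν, hν, ht⟩ := exists_limit_law
    exact ⟨ν, ν.2, hν, fun ν' _ hν' => hν'.unique hν moment_le, ht⟩
  · obtain ⟨k, rfl⟩ : ∃ k, n = k + 1 := ⟨n - 1, by omega⟩
    simpa using (integral_pathLengthLaw k 1).1
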